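/- Let $J_1,J_2,J_3$ be dimensions ($J_3\ge 1$), $R=\min\{J_1,J_2\}$, $\tau>1$, $0<p<1$ and $\rho>0$. For $x\in\mathbb R$ let $$\psi_{\tau,p}(x)=\begin{cases}|x|-\dfrac{|x|^{1+p}}{(1+p)\tau}, & |x|\le\tau^{1/p},\\[2mm] \dfrac{p\,\tau^{1/p}}{1+p}, & |x|>\tau^{1/p},\end{cases}\qquad P_\rho(y)=\operatorname*{arg\,min}_{x\in\mathbb R}\Big\{\tfrac12(x-y)^2+\rho\,\psi_{\tau,p}(x)\Big\},$$ where $\arg\min$ is the set of all global minimizers. For $\mathcal B\in\mathbb R^{J_1\times J_2\times J_3}$ let $\bar{\mathcal B}$ be the (unnormalized) discrete Fourier transform of $\mathcal B$ along the third mode, let $\bar{\mathcal B}^{(j)}\in\mathbb C^{J_1\times J_2}$ be its $j$-th frontal slice, with singular values $\sigma_1(\bar{\mathcal B}^{(j)})\ge\dots\ge\sigma_R(\bar{\mathcal B}^{(j)})\ge 0$, and put $$\|\mathcal B\|_{\tau p}=\frac1{J_3}\sum_{j=1}^{J_3}\sum_{k=1}^{R}\psi_{\tau,p}\big(\sigma_k(\bar{\mathcal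 B}^{(j)})\big),\qquad S_\rho(\mathcal Y)=\operatorname*{arg\,min}_{\mathcal B\in\mathbb R^{J_1\times J_2\times J_3}}\Big\{\tfrac12\|\mathcal B-\mathcal Y\|_F^2+\rho\|\mathcal B\|_{\tau p}\Big\}.$$ Let $*$ be the t-product (multiplication by the block circulant matrix of the left factor), $(\cdot)^H$ the tensor conjugate transpose. By a t-SVD of $\mathcal Y$ we mean a factorization $\mathcal Y=\mathcal M*\mathcal S_2*\mathcal Q^H$ with real orthogonal tensors $\mathcal M\in\mathbb R^{J_1\times J_1\times J_3}$, $\mathcal Q\in\mathbb R^{J_2\times J_2\times J_3}$ and a real f-diagonal tensor $\mathcal S_2\in\mathbb R^{J_1\times J_2\times J_3}$ (all frontal slices are diagonal) such that $\bar{\mathcal S}_2^{(j)}(k,k)=\sigma_k(\bar{\mathcal Y}^{(j)})$ for all $j,k$. Then, for every $\mathcal Y\in\mathbb R^{J_1\times J_2\times J_3}$: 1. $P_\rho(y)\neq\emptyset$ for every $y\in\mathbb R$, and $\mathcal Y$ has a t-SVD. 2. For every t-SVD $\mathcal Y=\mathcal M*\mathcal S_2*\mathcal Q^H$ and every function $P:\mathbb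 R\to\mathbb R$ with $P(y)\in P_\rho(y)$ for all $y$, there is exactly one real f-diagonal tensor $\mathcal S_1$ with $\bar{\mathcal S}_1^{(j)}(k,k)=P(\sigma_k(\bar{\mathcal Y}^{(j)}))$ for all $j,k$. The tensor $\mathcal B=\mathcal M*\mathcal S_1*\mathcal Q^H$ belongs to $S_\rho(\mathcal Y)$ and satisfies $\sigma_k(\bar{\mathcal B}^{(j)})=P(\sigma_k(\bar{\mathcal Y}^{(j)}))$ for all $j,k$. If moreover each set $P_\rho(\sigma_k(\bar{\mathcal Y}^{(j)}))$ has only one element, then $S_\rho(\mathcal Y)=\{\mathcal M*\mathcal S_1*\mathcal Q^H\}$. 3. A tensor $\mathcal B$ belongs to $S_\rho(\mathcal Y)$ if and only if there are t-SVDs $\mathcal Y=\mathcal M*\mathcal S_2*\mathcal Q^H$ and $\mathcal B=\mathcal M*\mathcal S_1*\mathcal Q^H$ with the same $\mathcal M$ and $\mathcal Q$, and $\sigma_k(\bar{\mathcal B}^{(j)})\in P_\rho(\sigma_k(\bar{\mathcal Y}^{(j)}))$ for all $j,k$. -/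

import Mathlib

open scoped Matrix

noncomputable section

namespace TensorProx

/-- Third-order tensors of size `J₁ × J₂ × J₃`, given by their frontal slices. The `J₃` slices are
numbered `0, …, J₃ - 1` and the number is read modulo `J₃`; `A j i l` is the entry at row `i` and
column `l` of slice `j`. -/
abbrev Tensor (α : Type) (J₁ J₂ J₃ : ℕ) : Type := ZMod J₃ → Matrix (Fin J₁) (Fin J₂) α

section Algebra

variable {J₁ J₂ J₃ I : ℕ}

/-- The block circulant matrix of a tensor: the block at position `(k, l)` is the slice `k - l`. -/
def bcirc (A : Tensor ℝ J₁ J₂ J₃) : Matrix (ZMod J₃ × Fin J₁) (ZMod J₃ × Fin J₂) ℝ :=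
  Matrix.of fun r c => A (r.1 - c.1) r.2 c.2

/-- The block vectorization: the frontal slices stacked on top of each other. -/
def bvec (A : Tensor ℝ J₁ J₂ J₃) : Matrix (ZMod J₃ × Fin J₁) (Fin J₂) ℝ :=
  Matrix.of fun r c => A r.1 r.2 c

/-- The inverse of the block vectorization. -/
def bvfold (X : Matrix (ZMod J₃ × Fin J₁) (Fin J₂) ℝ) : Tensor ℝ J₁ J₂ J₃ :=
  fun j => Matrix.of fun i l => X (j, i) l

/-- The t-product of two tensors. -/
def tProduct [NeZero J₃] (A : Tensor ℝ J₁ J₂ J₃) (B : Tensor ℝ J₂ I J₃) : Tensor ℝ J₁ I J₃ :=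
  bvfold (bcirc A * bvec B)

/-- The conjugate transpose of a tensor: every frontal slice is conjugate transposed, and the
order of all slices but the first one (number `0`) is reversed. -/
def tconj (A : Tensor ℝ J₁ J₂ J₃) : Tensor ℝ J₂ J₁ J₃ := fun j => (A (-j))ᴴ

/-- The identity tensor: the first frontal slice is the identity matrix, all others vanish. -/
def tid (J₁ J₃ : ℕ) : Tensor ℝ J₁ J₁ J₃ := fun j => if j = 0 then 1 else 0

/-- Orthogonal tensors. -/
def IsOrthogonal [NeZero J₃] (Q : Tensor ℝ J₁ J₁ J₃) : Prop :=
  tProduct Q (tconj Q) = tid J₁ J₃ ∧ tProduct (tconj Q) Q = tid J₁ J₃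

/-- f-diagonal tensors: every frontal slice is a (rectangular) diagonal matrix. -/
def IsFDiagonal (S : Tensor ℝ J₁ J₂ J₃) : Prop :=
  ∀ (j : ZMod J₃) (i : Fin J₁) (l : Fin J₂), (i : ℕ) ≠ (l : ℕ) → S j i l = 0

/-- `A = U ∗ S ∗ V^H` is a t-SVD of `A`. -/
structure IsTSVD [NeZero J₃] (A : Tensor ℝ J₁ J₂ J₃) (U : Tensor ℝ J₁ J₁ J₃)
    (S : Tensor ℝ J₁ J₂ J₃) (V : Tensor ℝ J₂ J₂ J₃) : Prop where
  left_orthogonal : IsOrthogonal U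
  right_orthogonal : IsOrthogonal V
  fdiagonal : IsFDiagonal S
  factorization : A = tProduct (tProduct U S) (tconj V)

/-- The discrete Fourier transform of a real tensor along the third mode (unnormalized, with
`ω = exp (-2πi / J₃)`). -/
def fft [NeZero J₃] (A : Tensor ℝ J₁ J₂ J₃) : Tensor ℂ J₁ J₂ J₃ :=
  ZMod.dft fun j => (A j).map Complex.ofReal

/-- The `k`-th largest singular value of a complex matrix, `k = 0, …, min J₁ J₂ - 1`. -/
def sigma (X : Matrix (Fin J₁) (Fin J₂) ℂ) (k : Fin (min J₁ J₂)) : ℝ :=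
  (Matrix.toEuclideanLin X).singularValues k

/-- The `(k, k)` entry of a `J₁ × J₂` matrix, for `k = 0, …, min J₁ J₂ - 1`. -/
def diagEntry (X : Matrix (Fin J₁) (Fin J₂) ℂ) (k : Fin (min J₁ J₂)) : ℂ :=
  X (Fin.castLE (min_le_left J₁ J₂) k) (Fin.castLE (min_le_right J₁ J₂) k)

/-- In the Fourier domain, the diagonal of each frontal slice of `S` lists the singular values of
the corresponding slice of `A`, in decreasing order. -/
def HasSingularDiagonal [NeZero J₃] (S A : Tensor ℝ J₁ J₂ J₃) : Prop :=
  ∀ (j : ZMod J₃) (k : Fin (min J₁ J₂)), diagEntry (fft S j) k = (sigma (fft A j) k : ℂ)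

/-- The Frobenius norm of a real tensor. -/
def frobNorm [NeZero J₃] (A : Tensor ℝ J₁ J₂ J₃) : ℝ :=
  √(∑ j, ∑ i, ∑ l, A j i l ^ 2)

end Algebra

/-- The minimax `p`-th order concave penalty (MPCP) function. -/
def mpcp (τ p x : ℝ) : ℝ :=
  if |x| ≤ τ ^ (1 / p) then |x| - |x| ^ (1 + p) / ((1 + p) * τ)
  else p * τ ^ (1 / p) / (1 + p)

/-- The proximal operator of the MPCP function, as a set-valued map: the set of all global
minimizers of `x ↦ (x - y)² / 2 + ρ ψ(x)` on the real line. -/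
def mpcpProx (τ p ρ y : ℝ) : Set ℝ :=
  {x | ∀ z : ℝ, 1 / 2 * (x - y) ^ 2 + ρ * mpcp τ p x ≤ 1 / 2 * (z - y) ^ 2 + ρ * mpcp τ p z}

/-- The tensor `p`-th order `τ` norm. -/
def tauNorm {J₁ J₂ J₃ : ℕ} [NeZero J₃] (τ p : ℝ) (B : Tensor ℝ J₁ J₂ J₃) : ℝ :=
  1 / (J₃ : ℝ) * ∑ j : ZMod J₃, ∑ k : Fin (min J₁ J₂), mpcp τ p (sigma (fft B j) k)

/-- The proximal operator of the tensor `p`-th order `τ` norm, as a set-valued map: the set of all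
global minimizers of `B ↦ ‖B - Y‖_F² / 2 + ρ ‖B‖_{τp}` over the real tensors. -/
def tauProx {J₁ J₂ J₃ : ℕ} [NeZero J₃] (τ p ρ : ℝ) (Y : Tensor ℝ J₁ J₂ J₃) :
    Set (Tensor ℝ J₁ J₂ J₃) :=
  {B | ∀ C : Tensor ℝ J₁ J₂ J₃,
    1 / 2 * frobNorm (B - Y) ^ 2 + ρ * tauNorm τ p B
      ≤ 1 / 2 * frobNorm (C - Y) ^ 2 + ρ * tauNorm τ p C}

end TensorProx

end

namespace TensorProx

open Matrix InnerProductSpace Module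

/-! The Fourier transform along the third mode turns the t-product into slicewise matrix
multiplication (`fft_tProduct`) and the Frobenius norm into an average of slice norms
(`frobNorm_sq`), so the objective splits into independent complex matrix problems. They are tied
together only by the conjugate symmetry between the slices at `q` and `-q` that characterizes
transforms of real tensors.

For one slice, von Neumann's trace inequality `frobInner_svd_le` bounds the distance of two matrices
below by the distance of their singular values. The objective is therefore at least a sum of scalar
prox objectives. The scalar prox is monotone and vanishes at 0, so shrinking the singular values of
`Y` gives a genuine ordered list, and the shrunken tensor attains the bound. Hence
`mem_tauProx_iff`: `B` is a minimizer iff its singular values are scalar minimizers and equality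
holds in every slice (`IsAligned`).

Equality means simultaneous decomposition: any SVD of the sum of two such matrices diagonalizes both
(`svd_of_frobInner_sub_self_le`). Applied to a t-SVD of the real tensor `B + Y`, this yields common
factors that are already real. Uniqueness then follows because a function of the singular values
does not depend on the chosen SVD (`svd_comp_eq`). -/

/-- The rectangular diagonal matrix with real diagonal entries `d 0, d 1, …`. -/
noncomputable def rectDiag (𝕜 : Type*) [RCLike 𝕜] (m n : ℕ) (d : ℕ → ℝ) : Matrix (Fin m) (Fin n) 𝕜 :=
  Matrix.of fun i l => if (i : ℕ) = l then (d i : 𝕜) else 0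

/-- The singular values of a matrix, as an infinite sequence. -/
noncomputable def singSeq {𝕜 : Type*} [RCLike 𝕜] {m n : ℕ} (A : Matrix (Fin m) (Fin n) 𝕜) (k : ℕ) : ℝ :=
  (Matrix.toEuclideanLin A).singularValues k

/-- Decreasing sequences vanishing from index `min m n` on. -/
structure IsSingularSeq (m n : ℕ) (d : ℕ → ℝ) : Prop where
  antitone : Antitone d
  eq_zero : ∀ k, min m n ≤ k → d k = 0

theorem IsSingularSeq.nonneg {m n : ℕ} {d : ℕ → ℝ} (h : IsSingularSeq m n d) (k : ℕ) :
    0 ≤ d k :=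
  (h.eq_zero (max k (min m n)) (le_max_right _ _)).symm.le.trans (h.antitone (le_max_left _ _))

theorem IsSingularSeq.add {m n : ℕ} {c d : ℕ → ℝ} (hc : IsSingularSeq m n c)
    (hd : IsSingularSeq m n d) : IsSingularSeq m n (fun k => c k + d k) where
  antitone _ _ h := add_le_add (hc.antitone h) (hd.antitone h)
  eq_zero k hk := by simp [hc.eq_zero k hk, hd.eq_zero k hk]

/-! ### Singular value decomposition of rectangular matrices -/

section SVD

variable {𝕜 : Type*} [RCLike 𝕜] {m n : ℕ}

theorem isSingularSeq_singSeq (A : Matrix (Fin m) (Fin n) 𝕜) :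
    IsSingularSeq m n (singSeq A) where
  antitone := (Matrix.toEuclideanLin A).singularValues_antitone
  eq_zero k hk := by
    rw [singSeq, LinearMap.singularValues_eq_zero_iff_le_finrank_range]
    refine le_trans (le_min ?_ ?_) hk
    · exact (Submodule.finrank_le _).trans_eq (by simp)
    · exact (LinearMap.finrank_range_le _).trans_eq (by simp)

theorem columns_mem_unitaryGroup {ι : Type*} [Fintype ι] [DecidableEq ι]
    (b : OrthonormalBasis ι 𝕜 (EuclideanSpace 𝕜 ι)) :
    (Matrix.of fun i k => b k i) ∈ unitaryGroup ι 𝕜 := by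
  have := (EuclideanSpace.basisFun ι 𝕜).toMatrix_orthonormalBasis_mem_unitary b
  convert this using 1
  ext i k
  simp [Module.Basis.toMatrix_apply]

/-- The right factor consists of eigenvectors of `T* T`. Their images under `T` are orthogonal with
norms the singular values; the nonzero ones are normalized and completed to an orthonormal basis,
which is the left factor. -/
theorem exists_svd (A : Matrix (Fin m) (Fin n) 𝕜) :
    ∃ U ∈ unitaryGroup (Fin m) 𝕜, ∃ V ∈ unitaryGroup (Fin n) 𝕜,
      A = U * rectDiag 𝕜 m n (singSeq A) * Vᴴ := by
  set T := Matrix.toEuclideanLin A with hTdef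
  set s := singSeq A with hs
  have hss := isSingularSeq_singSeq A
  have hfin : finrank 𝕜 (EuclideanSpace 𝕜 (Fin n)) = n := by simp
  set v := T.isSymmetric_adjoint_comp_self.eigenvectorBasis hfin with hv
  have hTT : ∀ i j, ⟪T (v i), T (v j)⟫_𝕜 = if i = j then ((s j ^ 2 : ℝ) : 𝕜) else 0 := by
    intro i j
    have h1 := T.isSymmetric_adjoint_comp_self.apply_eigenvectorBasis hfin j
    rw [← LinearMap.adjoint_inner_right]
    have h2 : (LinearMap.adjoint T) (T (v j)) = ((s j ^ 2 : ℝ) : 𝕜) • v j := by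
      rw [hs, singSeq, LinearMap.sq_singularValues_fin _ hfin]
      exact h1
    rw [h2, inner_smul_right, orthonormal_iff_ite.mp v.orthonormal i j]
    simp
  -- Only the indices with `0 < s i` matter: the completed basis `b` agrees with `w` there and is
  -- unconstrained elsewhere.
  set w : Fin m → EuclideanSpace 𝕜 (Fin m) := fun i =>
    if h : (i : ℕ) < n then ((s i)⁻¹ : 𝕜) • T (v ⟨i, h⟩) else 0 with hw
  have hlt : ∀ k, 0 < s k → k < m ∧ k < n := by
    intro k hk
    by_contra hcon
    exact hk.ne' (hss.eq_zero k (by omega))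
  have hort : Orthonormal 𝕜 (Set.domRestrict {i : Fin m | 0 < s i} w) := by
    rw [orthonormal_iff_ite]
    rintro ⟨i, hi⟩ ⟨j, hj⟩
    have hi' := (hlt i hi).2
    have hj' := (hlt j hj).2
    simp only [Set.domRestrict_apply, hw, hi', hj', dif_pos, inner_smul_left, inner_smul_right, hTT]
    have hjs : s j ≠ 0 := (show 0 < s j from hj).ne'
    have hjs' : (s j : 𝕜) ≠ 0 := by exact_mod_cast hjs
    by_cases hij : i = j
    · subst hij
      simp
      field_simp
    · have : ¬ (i : ℕ) = j := fun h => hij (Fin.ext h)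
      simp [hij, this]
  obtain ⟨b, hb⟩ := hort.exists_orthonormalBasis_extension_of_card_eq (by simp)
  have hTv : ∀ l : Fin n, ∀ i, T (v l) i = ∑ k : Fin m, b k i * rectDiag 𝕜 m n s k l := by
    intro l i
    by_cases hl : 0 < s l
    · have hlm := (hlt l hl).1
      rw [Finset.sum_eq_single (⟨l, hlm⟩ : Fin m)]
      · rw [hb ⟨l, hlm⟩ hl]
        have hls' : (s l : 𝕜) ≠ 0 := by exact_mod_cast hl.ne'
        simp [rectDiag, hw]
        field_simp
      · intro k _ hk
        have : ¬ (k : ℕ) = l := fun h => hk (Fin.ext h)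
        simp [rectDiag, this]
      · simp
    · have h0 : s l = 0 := le_antisymm (not_lt.mp hl) (hss.nonneg l)
      have : T (v l) = 0 := by
        rw [← inner_self_eq_zero (𝕜 := 𝕜), hTT, h0]; simp
      rw [this, Finset.sum_eq_zero]
      · simp
      · intro k _
        by_cases hk : (k : ℕ) = l <;> simp [rectDiag, hk, h0]
  refine ⟨_, columns_mem_unitaryGroup b, _, columns_mem_unitaryGroup v, ?_⟩
  have hV := mem_unitaryGroup_iff.mp (columns_mem_unitaryGroup v)
  rw [star_eq_conjTranspose] at hV
  have hAV : A * (Matrix.of fun i k => v k i) = (Matrix.of fun i k => b k i) * rectDiag 𝕜 m n s := by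
    ext i l
    have := hTv l i
    rw [hTdef, Matrix.toLpLin_apply] at this
    simpa [Matrix.mul_apply, Matrix.mulVec, dotProduct] using this
  rw [← hAV, Matrix.mul_assoc, hV, Matrix.mul_one]

end SVD

/-! ### Frobenius inner product and von Neumann's trace inequality -/

/-- The real inner product of matrices whose norm is the Frobenius norm. -/
noncomputable def frobInner {𝕜 : Type*} [RCLike 𝕜] {m n : ℕ} (A X : Matrix (Fin m) (Fin n) 𝕜) : ℝ :=
  RCLike.re (Aᴴ * X).trace

section VonNeumann

variable {𝕜 : Type*} [RCLike 𝕜] {m n : ℕ}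

theorem frobInner_comm (A X : Matrix (Fin m) (Fin n) 𝕜) : frobInner A X = frobInner X A := by
  have : Xᴴ * A = (Aᴴ * X)ᴴ := by simp
  rw [frobInner, frobInner, this, trace_conjTranspose, RCLike.star_def, RCLike.conj_re]

theorem frobInner_add_left (A B X : Matrix (Fin m) (Fin n) 𝕜) :
    frobInner (A + B) X = frobInner A X + frobInner B X := by
  simp [frobInner, Matrix.add_mul]

theorem frobInner_add_right (A X Z : Matrix (Fin m) (Fin n) 𝕜) :
    frobInner A (X + Z) = frobInner A X + frobInner A Z := by
  simp [frobInner, Matrix.mul_add]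

theorem frobInner_sub_self (A X : Matrix (Fin m) (Fin n) 𝕜) :
    frobInner (A - X) (A - X) = frobInner A A - 2 * frobInner A X + frobInner X X := by
  have : frobInner A X = frobInner X A := frobInner_comm A X
  simp only [frobInner, conjTranspose_sub, Matrix.sub_mul, Matrix.mul_sub, trace_sub, map_sub] at *
  linarith

theorem frobInner_self (A : Matrix (Fin m) (Fin n) 𝕜) :
    frobInner A A = ∑ i, ∑ l, ‖A i l‖ ^ 2 := by
  rw [frobInner, trace, Finset.sum_comm]
  simp only [diag_apply, mul_apply, conjTranspose_apply, map_sum]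
  refine Finset.sum_congr rfl fun i _ => Finset.sum_congr rfl fun l _ => ?_
  rw [RCLike.star_def, RCLike.conj_mul]
  norm_cast

theorem eq_of_frobInner_sub_self_le (A X : Matrix (Fin m) (Fin n) 𝕜)
    (h : frobInner (A - X) (A - X) ≤ 0) : A = X := by
  rw [frobInner_self] at h
  ext i l
  have h1 := (Finset.sum_eq_zero_iff_of_nonneg (fun i _ => by positivity)).mp
    (le_antisymm h (by positivity)) i (Finset.mem_univ i)
  have h2 := (Finset.sum_eq_zero_iff_of_nonneg (fun i _ => by positivity)).mp h1 l
    (Finset.mem_univ l)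
  simpa [sub_eq_zero] using h2

theorem rectDiag_add (c d : ℕ → ℝ) :
    rectDiag 𝕜 m n (fun k => c k + d k) = rectDiag 𝕜 m n c + rectDiag 𝕜 m n d := by
  ext i l
  by_cases h : (i : ℕ) = l <;> simp [rectDiag, h]

theorem IsSingularSeq.sum_fin {m n N : ℕ} {d : ℕ → ℝ} (hd : IsSingularSeq m n d)
    (hN : min m n ≤ N) (f : ℕ → ℝ) :
    ∑ i : Fin N, d i * f i = ∑ k : Fin (min m n), d k * f k := by
  rw [← Finset.sum_range (fun k => d k * f k), ← Finset.sum_range (fun k => d k * f k)]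
  symm
  refine Finset.sum_subset (by simpa using hN) fun k _ hk => ?_
  rw [hd.eq_zero k (by rw [Finset.mem_range] at hk; omega), zero_mul]

/-- A row beyond the last column has no diagonal entry, but there `d i = 0` as well. This lets sums
over a rectangular diagonal be traded for sums over the square index sets of `W` and `Z` in the
trace inequality. -/
theorem IsSingularSeq.sum_row {d : ℕ → ℝ} (hd : IsSingularSeq m n d) (i : Fin m) :
    ∑ l : Fin n, (if (i : ℕ) = l then d i else 0) = d i := by
  by_cases hi : (i : ℕ) < n
  · rw [Finset.sum_eq_single (⟨i, hi⟩ : Fin n)]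
    · simp
    · intro l _ hl
      exact if_neg fun h => hl (Fin.ext h.symm)
    · simp
  · rw [hd.eq_zero i (by omega)]
    simp

theorem IsSingularSeq.sum_column {d : ℕ → ℝ} (hd : IsSingularSeq m n d) (l : Fin n) :
    ∑ i : Fin m, (if (i : ℕ) = l then d i else 0) = d l := by
  rw [← IsSingularSeq.sum_row (m := n) (n := m) ⟨hd.antitone, by simpa [min_comm] using hd.eq_zero⟩ l]
  refine Finset.sum_congr rfl fun i _ => ?_
  by_cases h : (i : ℕ) = l
  · simp [h]
  · rw [if_neg h, if_neg (Ne.symm h)]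

theorem sum_comm_pairs {ι κ : Type*} [Fintype ι] [Fintype κ] (f : κ → κ → ι → ι → ℝ) :
    ∑ l, ∑ q, ∑ k, ∑ i, f l q k i = ∑ i, ∑ k, ∑ l, ∑ q, f l q k i := by
  calc _ = ∑ k, ∑ l, ∑ i, ∑ q, f l q k i := by
        rw [Finset.sum_comm]
        refine (Finset.sum_congr rfl fun l _ => Finset.sum_comm).trans ?_
        rw [Finset.sum_comm]
        refine Finset.sum_congr rfl fun k _ => ?_
        rw [Finset.sum_comm]
        exact Finset.sum_congr rfl fun l _ => Finset.sum_comm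
    _ = ∑ k, ∑ i, ∑ l, ∑ q, f l q k i := Finset.sum_congr rfl fun k _ => Finset.sum_comm
    _ = _ := Finset.sum_comm

/-- By Birkhoff's theorem the matrix is a convex combination of permutation matrices, and for each
permutation the bound is the rearrangement inequality. -/
theorem sum_le_of_mem_doublyStochastic {ι : Type*} [Fintype ι] [DecidableEq ι] {S : Matrix ι ι ℝ}
    (hS : S ∈ doublyStochastic ℝ ι) {a x : ι → ℝ} (h : Monovary a x) :
    ∑ i, ∑ k, a i * x k * S i k ≤ ∑ i, a i * x i := by
  obtain ⟨w, hw0, hw1, rfl⟩ := exists_eq_sum_perm_of_mem_doublyStochastic hS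
  have key : ∑ i, ∑ k, a i * x k * (∑ σ : Equiv.Perm ι, w σ • σ.permMatrix ℝ) i k
      = ∑ σ : Equiv.Perm ι, w σ * ∑ i, a i * x (σ i) := by
    have hentry : ∀ i k, (∑ σ : Equiv.Perm ι, w σ • σ.permMatrix ℝ) i k
        = ∑ σ : Equiv.Perm ι, w σ * if σ i = k then 1 else 0 := by
      intro i k
      rw [Matrix.sum_apply]
      refine Finset.sum_congr rfl fun σ _ => ?_
      rw [Matrix.smul_apply, smul_eq_mul]
      simp [Equiv.Perm.permMatrix, PEquiv.toMatrix_apply, eq_comm]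
    simp only [hentry, Finset.mul_sum]
    conv_rhs => rw [Finset.sum_comm]
    refine Finset.sum_congr rfl fun i _ => ?_
    rw [Finset.sum_comm]
    refine Finset.sum_congr rfl fun σ _ => ?_
    rw [Finset.sum_eq_single (σ i)]
    · simp only [if_true]
      ring
    · intro k _ hk
      simp [hk.symm]
    · simp
  rw [key]
  calc _ ≤ ∑ σ : Equiv.Perm ι, w σ * ∑ i, a i * x i :=
        Finset.sum_le_sum fun σ _ => mul_le_mul_of_nonneg_left
          h.sum_mul_comp_perm_le_sum_mul (hw0 σ)
    _ = _ := by rw [← Finset.sum_mul, hw1, one_mul]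

theorem sq_norm_mem_doublyStochastic {ι : Type*} [Fintype ι] [DecidableEq ι] {W : Matrix ι ι 𝕜}
    (hW : W ∈ unitaryGroup ι 𝕜) : (Matrix.of fun i k => ‖W i k‖ ^ 2) ∈ doublyStochastic ℝ ι := by
  rw [mem_doublyStochastic_iff_sum]
  refine ⟨fun i k => by simp, fun i => ?_, fun k => ?_⟩
  · have := congrFun (congrFun (mem_unitaryGroup_iff.mp hW) i) i
    simp only [mul_apply, star_apply, RCLike.star_def, RCLike.mul_conj, one_apply_eq] at this
    exact_mod_cast this
  · have := congrFun (congrFun (mem_unitaryGroup_iff'.mp hW) k) k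
    simp only [mul_apply, star_apply, RCLike.star_def, RCLike.conj_mul, one_apply_eq] at this
    exact_mod_cast this

/-- The trace is a combination of terms `Re (W i k * Z q l)` with nonnegative weights. Bounding each
by `(‖W i k‖² + ‖Z q l‖²) / 2` decouples the two unitaries; summing out the free indices leaves two
sums against doubly stochastic matrices. -/
theorem trace_rectDiag_mul_le {a x : ℕ → ℝ} (ha : IsSingularSeq m n a) (hx : IsSingularSeq m n x)
    {W : Matrix (Fin m) (Fin m) 𝕜} (hW : W ∈ unitaryGroup (Fin m) 𝕜)
    {Z : Matrix (Fin n) (Fin n) 𝕜} (hZ : Z ∈ unitaryGroup (Fin n) 𝕜) :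
    RCLike.re ((rectDiag 𝕜 m n a)ᴴ * W * rectDiag 𝕜 m n x * Z).trace
      ≤ ∑ k : Fin (min m n), a k * x k := by
  set α : Fin m → Fin n → ℝ := fun i l => if (i : ℕ) = l then a i else 0 with hα
  set ξ : Fin m → Fin n → ℝ := fun i l => if (i : ℕ) = l then x i else 0 with hξ
  have hα0 : ∀ i l, 0 ≤ α i l := fun i l => by
    simp only [hα]; split_ifs
    exacts [ha.nonneg _, le_rfl]
  have hξ0 : ∀ i l, 0 ≤ ξ i l := fun i l => by
    simp only [hξ]; split_ifs
    exacts [hx.nonneg _, le_rfl]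
  have hDa : rectDiag 𝕜 m n a = Matrix.of fun i l => (α i l : 𝕜) := by
    ext i l; simp only [rectDiag, hα, of_apply]; split_ifs <;> simp
  have hDx : rectDiag 𝕜 m n x = Matrix.of fun i l => (ξ i l : 𝕜) := by
    ext i l; simp only [rectDiag, hξ, of_apply]; split_ifs <;> simp
  have htr : RCLike.re ((rectDiag 𝕜 m n a)ᴴ * W * rectDiag 𝕜 m n x * Z).trace
      = ∑ l, ∑ q, ∑ k, ∑ i, α i l * ξ k q * RCLike.re (W i k * Z q l) := by
    rw [hDa, hDx]
    simp only [trace, diag_apply, mul_apply, conjTranspose_apply, of_apply, Finset.sum_mul,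
      map_sum]
    refine Finset.sum_congr rfl fun l _ => Finset.sum_congr rfl fun q _ =>
      Finset.sum_congr rfl fun k _ => Finset.sum_congr rfl fun i _ => ?_
    rw [← RCLike.re_ofReal_mul]
    congr 1
    simp
    ring
  rw [htr]
  have hbound : ∀ i k q l, α i l * ξ k q * RCLike.re (W i k * Z q l)
      ≤ α i l * ξ k q * ‖W i k‖ ^ 2 / 2 + α i l * ξ k q * ‖Z q l‖ ^ 2 / 2 := by
    intro i k q l
    have h1 : RCLike.re (W i k * Z q l) ≤ ‖W i k‖ * ‖Z q l‖ :=
      (RCLike.re_le_norm _).trans_eq (norm_mul _ _)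
    have h2 : ‖W i k‖ * ‖Z q l‖ ≤ (‖W i k‖ ^ 2 + ‖Z q l‖ ^ 2) / 2 := by
      nlinarith [sq_nonneg (‖W i k‖ - ‖Z q l‖)]
    have := mul_le_mul_of_nonneg_left (h1.trans h2) (mul_nonneg (hα0 i l) (hξ0 k q))
    linarith
  have hW2 : ∑ l, ∑ q, ∑ k, ∑ i, α i l * ξ k q * ‖W i k‖ ^ 2
      = ∑ i : Fin m, ∑ k : Fin m, a i * x k * ‖W i k‖ ^ 2 := by
    have : ∀ i k : Fin m, a i * x k * ‖W i k‖ ^ 2 = ∑ l, ∑ q, α i l * ξ k q * ‖W i k‖ ^ 2 := by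
      intro i k
      rw [← ha.sum_row i, ← hx.sum_row k, Finset.sum_mul_sum, Finset.sum_mul]
      simp only [Finset.sum_mul, hα, hξ]
    simp only [this]
    exact sum_comm_pairs _
  have hZ2 : ∑ l, ∑ q, ∑ k, ∑ i, α i l * ξ k q * ‖Z q l‖ ^ 2
      = ∑ q : Fin n, ∑ l : Fin n, x q * a l * ‖Z q l‖ ^ 2 := by
    have : ∀ q l : Fin n, x q * a l * ‖Z q l‖ ^ 2 = ∑ k, ∑ i, α i l * ξ k q * ‖Z q l‖ ^ 2 := by
      intro q l
      rw [← ha.sum_column l, ← hx.sum_column q, Finset.sum_mul_sum, Finset.sum_mul]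
      simp only [Finset.sum_mul, hα, hξ]
      refine Finset.sum_congr rfl fun k _ => Finset.sum_congr rfl fun i _ => ?_
      ring
    simp only [this]
    exact Finset.sum_comm
  have hb1 : ∑ i : Fin m, ∑ k : Fin m, a i * x k * ‖W i k‖ ^ 2
      ≤ ∑ k : Fin (min m n), a k * x k := by
    rw [← ha.sum_fin (min_le_left m n) x]
    exact sum_le_of_mem_doublyStochastic (sq_norm_mem_doublyStochastic hW)
      (a := fun i : Fin m => a i) (x := fun i : Fin m => x i)
      (Antitone.monovary (fun _ _ h => ha.antitone h) (fun _ _ h => hx.antitone h))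
  have hb2 : ∑ q : Fin n, ∑ l : Fin n, x q * a l * ‖Z q l‖ ^ 2
      ≤ ∑ k : Fin (min m n), a k * x k := by
    rw [← ha.sum_fin (min_le_right m n) x]
    simp only [mul_comm (a _) (x _)]
    exact sum_le_of_mem_doublyStochastic (sq_norm_mem_doublyStochastic hZ)
      (a := fun i : Fin n => x i) (x := fun i : Fin n => a i)
      (Antitone.monovary (fun _ _ h => hx.antitone h) (fun _ _ h => ha.antitone h))
  calc _ ≤ ∑ l, ∑ q, ∑ k, ∑ i, (α i l * ξ k q * ‖W i k‖ ^ 2 / 2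
            + α i l * ξ k q * ‖Z q l‖ ^ 2 / 2) :=
        Finset.sum_le_sum fun l _ => Finset.sum_le_sum fun q _ =>
          Finset.sum_le_sum fun k _ => Finset.sum_le_sum fun i _ => hbound i k q l
    _ = (∑ l, ∑ q, ∑ k, ∑ i, α i l * ξ k q * ‖W i k‖ ^ 2) / 2
          + (∑ l, ∑ q, ∑ k, ∑ i, α i l * ξ k q * ‖Z q l‖ ^ 2) / 2 := by
        simp only [Finset.sum_add_distrib, Finset.sum_div]
    _ ≤ _ := by rw [hW2, hZ2]; linarith

/-- Von Neumann's trace inequality. -/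
theorem frobInner_svd_le {a x : ℕ → ℝ} (ha : IsSingularSeq m n a) (hx : IsSingularSeq m n x)
    {U U' : Matrix (Fin m) (Fin m) 𝕜} (hU : U ∈ unitaryGroup (Fin m) 𝕜)
    (hU' : U' ∈ unitaryGroup (Fin m) 𝕜) {V V' : Matrix (Fin n) (Fin n) 𝕜}
    (hV : V ∈ unitaryGroup (Fin n) 𝕜) (hV' : V' ∈ unitaryGroup (Fin n) 𝕜) :
    frobInner (U * rectDiag 𝕜 m n a * Vᴴ) (U' * rectDiag 𝕜 m n x * V'ᴴ)
      ≤ ∑ k : Fin (min m n), a k * x k := by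
  refine le_of_eq_of_le ?_ (trace_rectDiag_mul_le ha hx (mul_mem (Unitary.star_mem hU) hU')
    (mul_mem (Unitary.star_mem hV') hV))
  simp only [frobInner, conjTranspose_mul, conjTranspose_conjTranspose, star_eq_conjTranspose]
  rw [← Matrix.mul_assoc _ _ V, Matrix.trace_mul_comm _ V]
  simp only [Matrix.mul_assoc]

theorem frobInner_svd_same {a x : ℕ → ℝ} (ha : IsSingularSeq m n a)
    {U : Matrix (Fin m) (Fin m) 𝕜} (hU : U ∈ unitaryGroup (Fin m) 𝕜)
    {V : Matrix (Fin n) (Fin n) 𝕜} (hV : V ∈ unitaryGroup (Fin n) 𝕜) :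
    frobInner (U * rectDiag 𝕜 m n a * Vᴴ) (U * rectDiag 𝕜 m n x * Vᴴ)
      = ∑ k : Fin (min m n), a k * x k := by
  have hU1 : Uᴴ * U = 1 := mem_unitaryGroup_iff'.mp hU
  have hV1 : Vᴴ * V = 1 := mem_unitaryGroup_iff'.mp hV
  have h1 : frobInner (U * rectDiag 𝕜 m n a * Vᴴ) (U * rectDiag 𝕜 m n x * Vᴴ)
      = RCLike.re ((rectDiag 𝕜 m n a)ᴴ * rectDiag 𝕜 m n x).trace := by
    simp only [frobInner, conjTranspose_mul, conjTranspose_conjTranspose]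
    rw [Matrix.mul_assoc V, Matrix.trace_mul_comm V]
    simp only [Matrix.mul_assoc]
    rw [hV1, Matrix.mul_one, ← Matrix.mul_assoc Uᴴ, hU1, Matrix.one_mul]
  rw [h1, ← ha.sum_fin (min_le_left m n)]
  simp only [trace, diag_apply, mul_apply, conjTranspose_apply, map_sum]
  rw [Finset.sum_comm]
  refine Finset.sum_congr rfl fun i _ => ?_
  rw [← ha.sum_row i, Finset.sum_mul]
  refine Finset.sum_congr rfl fun l _ => ?_
  by_cases h : (i : ℕ) = l
  · simp [rectDiag, h]
  · simp [rectDiag, h]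

end VonNeumann

/-! ### Uniqueness of singular values, the equality case, functions of singular values -/

theorem IsSingularSeq.ext {m n : ℕ} {c d : ℕ → ℝ} (hc : IsSingularSeq m n c)
    (hd : IsSingularSeq m n d) (h : ∀ k : Fin (min m n), c k = d k) : c = d := by
  funext k
  rcases lt_or_ge k (min m n) with hk | hk
  · exact h ⟨k, hk⟩
  · rw [hc.eq_zero k hk, hd.eq_zero k hk]

theorem IsSingularSeq.ext_of_sum_sq {m n : ℕ} {c d : ℕ → ℝ} (hc : IsSingularSeq m n c)
    (hd : IsSingularSeq m n d) (h : ∑ k : Fin (min m n), (c k - d k) ^ 2 ≤ 0) : c = d := by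
  refine hc.ext hd fun k => ?_
  have := (Finset.sum_eq_zero_iff_of_nonneg (fun k _ => by positivity)).mp
    (le_antisymm h (by positivity)) k (Finset.mem_univ k)
  simpa [sub_eq_zero] using this

theorem sum_sub_sq {N : ℕ} (c d : ℕ → ℝ) : ∑ k : Fin N, (c k - d k) ^ 2
    = ∑ k : Fin N, c k * c k - 2 * ∑ k : Fin N, c k * d k + ∑ k : Fin N, d k * d k := by
  rw [Finset.mul_sum, ← Finset.sum_sub_distrib, ← Finset.sum_add_distrib]
  exact Finset.sum_congr rfl fun k _ => by ring

section Simultaneous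

variable {𝕜 : Type*} [RCLike 𝕜] {m n : ℕ}

theorem frobInner_le (A X : Matrix (Fin m) (Fin n) 𝕜) :
    frobInner A X ≤ ∑ k : Fin (min m n), singSeq A k * singSeq X k := by
  obtain ⟨U, hU, V, hV, hA⟩ := exists_svd A
  obtain ⟨U', hU', V', hV', hX⟩ := exists_svd X
  conv_lhs => rw [hA, hX]
  exact frobInner_svd_le (isSingularSeq_singSeq A) (isSingularSeq_singSeq X) hU hU' hV hV'

theorem frobInner_self_eq_sum (A : Matrix (Fin m) (Fin n) 𝕜) :
    frobInner A A = ∑ k : Fin (min m n), singSeq A k * singSeq A k := by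
  obtain ⟨U, hU, V, hV, hA⟩ := exists_svd A
  conv_lhs => rw [hA]
  exact frobInner_svd_same (isSingularSeq_singSeq A) hU hV

/-- The singular values of a matrix are determined by any singular value decomposition. -/
theorem singSeq_eq_of_svd {A : Matrix (Fin m) (Fin n) 𝕜} {d : ℕ → ℝ} (hd : IsSingularSeq m n d)
    {U : Matrix (Fin m) (Fin m) 𝕜} (hU : U ∈ unitaryGroup (Fin m) 𝕜)
    {V : Matrix (Fin n) (Fin n) 𝕜} (hV : V ∈ unitaryGroup (Fin n) 𝕜)
    (hA : A = U * rectDiag 𝕜 m n d * Vᴴ) : singSeq A = d := by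
  obtain ⟨U', hU', V', hV', hA'⟩ := exists_svd A
  have hs := isSingularSeq_singSeq A
  refine hs.ext_of_sum_sq hd ?_
  have h1 : frobInner A A = ∑ k : Fin (min m n), d k * d k := by
    conv_lhs => rw [hA]
    exact frobInner_svd_same hd hU hV
  -- The trace inequality for `A` against itself, written with its two decompositions; with both
  -- expressions of `frobInner A A` it makes the squared distance of the two lists nonpositive.
  have h2 : frobInner A A ≤ ∑ k : Fin (min m n), singSeq A k * d k := by
    conv_lhs => congr; rw [hA']
    conv_lhs => arg 2; rw [hA]
    exact frobInner_svd_le hs hd hU' hU hV' hV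
  rw [sum_sub_sq]
  linarith [frobInner_self_eq_sum A]

/-- After both squares are expanded the pure terms agree, and the cross terms are compared by the
trace inequality. -/
theorem sum_sq_sub_singSeq_le (A X : Matrix (Fin m) (Fin n) 𝕜) :
    ∑ k : Fin (min m n), (singSeq A k - singSeq X k) ^ 2 ≤ frobInner (A - X) (A - X) := by
  rw [frobInner_sub_self, sum_sub_sq]
  linarith [frobInner_le A X, frobInner_self_eq_sum A, frobInner_self_eq_sum X]

/-- In the equality case of von Neumann's trace inequality, every singular value decomposition of
the sum of the two matrices diagonalizes both of them. -/
theorem svd_of_frobInner_sub_self_le {A X : Matrix (Fin m) (Fin n) 𝕜}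
    (h : frobInner (A - X) (A - X) ≤ ∑ k : Fin (min m n), (singSeq A k - singSeq X k) ^ 2)
    {c : ℕ → ℝ} (hc : IsSingularSeq m n c)
    {U : Matrix (Fin m) (Fin m) 𝕜} (hU : U ∈ unitaryGroup (Fin m) 𝕜)
    {V : Matrix (Fin n) (Fin n) 𝕜} (hV : V ∈ unitaryGroup (Fin n) 𝕜)
    (hAX : A + X = U * rectDiag 𝕜 m n c * Vᴴ) :
    A = U * rectDiag 𝕜 m n (singSeq A) * Vᴴ ∧ X = U * rectDiag 𝕜 m n (singSeq X) * Vᴴ := by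
  have ha := isSingularSeq_singSeq A
  have hx := isSingularSeq_singSeq X
  set a := singSeq A
  set x := singSeq X
  have hAA : frobInner A A = _ := frobInner_self_eq_sum A
  have hXX : frobInner X X = _ := frobInner_self_eq_sum X
  have hAX' : frobInner A X ≤ _ := frobInner_le A X
  rw [frobInner_sub_self, sum_sub_sq] at h
  have hle : ∀ (B : Matrix (Fin m) (Fin n) 𝕜) (d : ℕ → ℝ), IsSingularSeq m n d →
      frobInner B (U * rectDiag 𝕜 m n d * Vᴴ) ≤ ∑ k : Fin (min m n), singSeq B k * d k := by
    intro B d hd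
    obtain ⟨U', hU', V', hV', hB⟩ := exists_svd B
    conv_lhs => rw [hB]
    exact frobInner_svd_le (isSingularSeq_singSeq B) hd hU' hU hV' hV
  have hcc : frobInner (A + X) (A + X) = ∑ k : Fin (min m n), c k * c k := by
    rw [hAX]; exact frobInner_svd_same hc hU hV
  have hexp : frobInner (A + X) (A + X) = frobInner A A + 2 * frobInner A X + frobInner X X := by
    rw [frobInner_add_left, frobInner_add_right, frobInner_add_right, frobInner_comm X A]
    ring
  have hexp' : frobInner (A + X) (A + X) ≤ ∑ k : Fin (min m n), a k * c k
      + ∑ k : Fin (min m n), x k * c k := by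
    rw [frobInner_add_left, hAX]
    exact add_le_add (hle A c hc) (hle X c hc)
  -- The hypothesis forces equality in the trace inequality for `A` and `X`, so `‖A + X‖² = ‖a +
  -- x‖²`. Since also `‖A + X‖² = ‖c‖² ≤ ⟨a + x, c⟩`, the distance between `c` and `a + x` is zero.
  have hce : c = fun k => a k + x k := by
    refine hc.ext_of_sum_sq (ha.add hx) ?_
    have e0 := sum_sub_sq (N := min m n) c (fun k => a k + x k)
    beta_reduce at e0
    rw [e0]
    have e1 : ∑ k : Fin (min m n), c k * (a k + x k)
        = ∑ k : Fin (min m n), a k * c k + ∑ k : Fin (min m n), x k * c k := by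
      rw [← Finset.sum_add_distrib]; exact Finset.sum_congr rfl fun k _ => by ring
    have e2 : ∑ k : Fin (min m n), (a k + x k) * (a k + x k)
        = ∑ k : Fin (min m n), a k * a k + 2 * ∑ k : Fin (min m n), a k * x k
          + ∑ k : Fin (min m n), x k * x k := by
      rw [Finset.mul_sum, ← Finset.sum_add_distrib, ← Finset.sum_add_distrib]
      exact Finset.sum_congr rfl fun k _ => by ring
    rw [e1, e2]
    linarith
  set D := U * rectDiag 𝕜 m n a * Vᴴ with hD
  set F := U * rectDiag 𝕜 m n x * Vᴴ with hF
  have hsum : A + X = D + F := by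
    rw [hAX, hce, rectDiag_add, Matrix.mul_add, Matrix.add_mul]
  have hDD : frobInner D D = _ := frobInner_svd_same ha hU hV
  have hFF : frobInner F F = _ := frobInner_svd_same hx hU hV
  have hDF : frobInner D F = _ := frobInner_svd_same ha hU hV
  -- These four upper bounds add up to the value of `⟨A + X, D + F⟩` in `htot`, so each is an
  -- equality; then `‖A - D‖² = 0` and `‖X - F‖² = 0`.
  have i1 : frobInner A D ≤ _ := hle A a ha
  have i2 : frobInner A F ≤ _ := hle A x hx
  have i3 : frobInner X D ≤ _ := hle X a ha
  have i4 : frobInner X F ≤ _ := hle X x hx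
  have hxa : ∑ k : Fin (min m n), x k * a k = ∑ k : Fin (min m n), a k * x k :=
    Finset.sum_congr rfl fun k _ => mul_comm _ _
  have htot : frobInner (A + X) (D + F)
      = frobInner D D + 2 * frobInner D F + frobInner F F := by
    rw [hsum, frobInner_add_left, frobInner_add_right, frobInner_add_right, frobInner_comm F D]
    ring
  rw [frobInner_add_left, frobInner_add_right, frobInner_add_right] at htot
  constructor
  · apply eq_of_frobInner_sub_self_le
    rw [frobInner_sub_self]
    linarith
  · apply eq_of_frobInner_sub_self_le
    rw [frobInner_sub_self]
    linarith

theorem rectDiag_mul_conjTranspose {d : ℕ → ℝ} (hd : IsSingularSeq m n d) :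
    rectDiag 𝕜 m n d * (rectDiag 𝕜 m n d)ᴴ = diagonal fun i : Fin m => ((d i ^ 2 : ℝ) : 𝕜) := by
  ext i k
  simp only [mul_apply, conjTranspose_apply]
  by_cases hik : i = k
  · subst hik
    rw [diagonal_apply_eq, sq]
    have hrow : d i * d i = ∑ l : Fin n, (if (i : ℕ) = l then d i else 0) * d i := by
      rw [← Finset.sum_mul, hd.sum_row]
    rw [hrow, RCLike.ofReal_sum]
    refine Finset.sum_congr rfl fun l _ => ?_
    by_cases h : (i : ℕ) = l
    · simp [rectDiag, h]
    · simp [rectDiag, h]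
  · rw [diagonal_apply_ne _ hik]
    refine Finset.sum_eq_zero fun l _ => ?_
    by_cases h : (i : ℕ) = l
    · have : ¬ (k : ℕ) = l := fun h' => hik (Fin.ext (h.trans h'.symm))
      simp [rectDiag, this]
    · simp [rectDiag, h]

/-- Applying a function to the singular values does not depend on the singular value
decomposition. -/
theorem svd_comp_eq {d : ℕ → ℝ} (hd : IsSingularSeq m n d) {f : ℝ → ℝ} (hf : f 0 = 0)
    {U U' : Matrix (Fin m) (Fin m) 𝕜} (hU : U ∈ unitaryGroup (Fin m) 𝕜)
    (hU' : U' ∈ unitaryGroup (Fin m) 𝕜) {V V' : Matrix (Fin n) (Fin n) 𝕜}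
    (hV : V ∈ unitaryGroup (Fin n) 𝕜) (hV' : V' ∈ unitaryGroup (Fin n) 𝕜)
    (h : U * rectDiag 𝕜 m n d * Vᴴ = U' * rectDiag 𝕜 m n d * V'ᴴ) :
    U * rectDiag 𝕜 m n (fun k => f (d k)) * Vᴴ
      = U' * rectDiag 𝕜 m n (fun k => f (d k)) * V'ᴴ := by
  have hU1 : Uᴴ * U = 1 := mem_unitaryGroup_iff'.mp hU
  have hU2 : U * Uᴴ = 1 := mem_unitaryGroup_iff.mp hU
  have hU1' : U'ᴴ * U' = 1 := mem_unitaryGroup_iff'.mp hU'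
  have hU2' : U' * U'ᴴ = 1 := mem_unitaryGroup_iff.mp hU'
  have hV1 : Vᴴ * V = 1 := mem_unitaryGroup_iff'.mp hV
  have hV2 : V * Vᴴ = 1 := mem_unitaryGroup_iff.mp hV
  have hV1' : V'ᴴ * V' = 1 := mem_unitaryGroup_iff'.mp hV'
  have hV2' : V' * V'ᴴ = 1 := mem_unitaryGroup_iff.mp hV'
  set D := rectDiag 𝕜 m n d
  set W := U'ᴴ * U with hW
  set Z := V'ᴴ * V with hZ
  have hWD : W * D = D * Z := by
    have := congrArg (fun M => U'ᴴ * M * V) h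
    simp only [Matrix.mul_assoc] at this
    rw [hV1, Matrix.mul_one, ← Matrix.mul_assoc U'ᴴ U', hU1', Matrix.one_mul] at this
    rw [hW, hZ, Matrix.mul_assoc]
    exact this
  have hDW : Dᴴ * W = Z * Dᴴ := by
    have := congrArg (fun M => V'ᴴ * Mᴴ * U) h
    simp only [conjTranspose_mul, conjTranspose_conjTranspose, Matrix.mul_assoc] at this
    rw [hU1, Matrix.mul_one, ← Matrix.mul_assoc V'ᴴ V', hV1', Matrix.one_mul] at this
    rw [hW, hZ, Matrix.mul_assoc]
    exact this.symm
  -- Commuting with the diagonal matrix of the `d i ^ 2` makes `W` block diagonal over equal values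
  -- of `d`, so `W` commutes with every diagonal matrix that is a function of `d`, in particular
  -- with `G`.
  have hcomm : W * (D * Dᴴ) = (D * Dᴴ) * W := by
    rw [← Matrix.mul_assoc, hWD, Matrix.mul_assoc, ← hDW, Matrix.mul_assoc]
  -- Where `d i = 0` the quotient is the default 0; the factorization through `D` survives because
  -- `f 0 = 0`.
  set G : Matrix (Fin m) (Fin m) 𝕜 := diagonal fun i : Fin m => ((f (d i) / d i : ℝ) : 𝕜) with hG
  have hcommG : W * G = G * W := by
    ext i k
    have h1 := congrFun (congrFun hcomm i) k
    rw [rectDiag_mul_conjTranspose hd, mul_diagonal, diagonal_mul] at h1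
    rw [hG, mul_diagonal, diagonal_mul]
    by_cases hik : d i = d k
    · rw [hik, mul_comm]
    · have hne : ((d k ^ 2 : ℝ) : 𝕜) ≠ ((d i ^ 2 : ℝ) : 𝕜) := by
        intro h2
        have h3 : d k ^ 2 = d i ^ 2 := by exact_mod_cast h2
        exact hik ((sq_eq_sq₀ (hd.nonneg _) (hd.nonneg _)).mp h3.symm)
      have : W i k = 0 := by
        rw [mul_comm, ← sub_eq_zero, ← sub_mul] at h1
        exact (mul_eq_zero.mp h1).resolve_left (sub_ne_zero.mpr hne)
      simp [this]
  have hGD : rectDiag 𝕜 m n (fun k => f (d k)) = G * D := by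
    ext i l
    rw [hG, diagonal_mul]
    by_cases hil : (i : ℕ) = l
    · by_cases h0 : d l = 0
      · simp [D, rectDiag, hil, h0, hf]
      · simp only [D, rectDiag, hil, of_apply, if_true]
        rw [← RCLike.ofReal_mul, div_mul_cancel₀ _ h0]
    · simp [D, rectDiag, hil]
  rw [hGD]
  have key : W * (G * D) = G * D * Z := by
    rw [← Matrix.mul_assoc, hcommG, Matrix.mul_assoc, hWD, Matrix.mul_assoc]
  calc U * (G * D) * Vᴴ = U' * (W * (G * D)) * Vᴴ := by
        rw [hW, ← Matrix.mul_assoc U', ← Matrix.mul_assoc U', hU2', Matrix.one_mul]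
    _ = U' * (G * D) * V'ᴴ := by
        rw [key, hZ]
        simp only [Matrix.mul_assoc]
        rw [hV2, Matrix.mul_one]

end Simultaneous

/-! ### The t-product in the Fourier domain -/

section Fourier

variable {J₁ J₂ J₃ I : ℕ} [NeZero J₃]

theorem fft_apply (A : Tensor ℝ J₁ J₂ J₃) (q : ZMod J₃) :
    fft A q = ∑ j, ZMod.stdAddChar (-(j * q)) • (A j).map Complex.ofReal :=
  ZMod.dft_apply _ _

theorem fft_apply_apply (A : Tensor ℝ J₁ J₂ J₃) (q : ZMod J₃) (i : Fin J₁) (l : Fin J₂) :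
    fft A q i l = ∑ j, ZMod.stdAddChar (-(j * q)) * (A j i l : ℂ) := by
  simp [fft_apply, Matrix.sum_apply]

theorem tProduct_apply (A : Tensor ℝ J₁ J₂ J₃) (B : Tensor ℝ J₂ I J₃) (j : ZMod J₃) :
    tProduct A B j = ∑ k, A (j - k) * B k := by
  ext i l
  simp [tProduct, bvfold, bcirc, bvec, mul_apply, Matrix.sum_apply, Fintype.sum_prod_type]

/-- The t-product is the cyclic convolution of the slices, so this is the convolution theorem. -/
theorem fft_tProduct (A : Tensor ℝ J₁ J₂ J₃) (B : Tensor ℝ J₂ I J₃) (q : ZMod J₃) :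
    fft (tProduct A B) q = fft A q * fft B q := by
  have hmap : ∀ j, (tProduct A B j).map Complex.ofReal
      = ∑ k, (A (j - k)).map Complex.ofReal * (B k).map Complex.ofReal := by
    intro j
    ext i l
    simp [tProduct_apply, Matrix.sum_apply, mul_apply]
  rw [fft_apply, fft_apply, fft_apply, Matrix.sum_mul]
  simp only [hmap, Matrix.mul_sum, Finset.smul_sum, Matrix.smul_mul, Matrix.mul_smul]
  rw [Finset.sum_comm]
  conv_rhs => rw [Finset.sum_comm]
  refine Finset.sum_congr rfl fun k _ => ?_
  refine Fintype.sum_equiv (Equiv.subRight k) _ _ fun j => ?_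
  rw [Equiv.subRight_apply, smul_smul, ← AddChar.map_add_eq_mul]
  congr 2
  ring

theorem dft_map_star (Φ : Tensor ℂ J₁ J₂ J₃) (q : ZMod J₃) :
    ZMod.dft (fun j => (Φ j).map star) q = (ZMod.dft Φ (-q)).map star := by
  ext i l
  simp only [ZMod.dft_apply, Matrix.sum_apply, Matrix.map_apply, Matrix.smul_apply, star_sum,
    smul_eq_mul, star_mul']
  refine Finset.sum_congr rfl fun j _ => ?_
  congr 1
  rw [Complex.star_def, ← AddChar.map_neg_eq_conj]
  congr 1
  ring

theorem fft_neg_index (A : Tensor ℝ J₁ J₂ J₃) (q : ZMod J₃) :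
    fft A (-q) = (fft A q).map star := by
  have h := dft_map_star (fun j => (A j).map Complex.ofReal) (-q)
  rw [neg_neg] at h
  rw [fft, ← h]
  have hreal : (fun j => ((A j).map Complex.ofReal).map star)
      = fun j => (A j).map Complex.ofReal := by
    funext j
    ext i l
    simp
  rw [hreal]

theorem fft_tconj (A : Tensor ℝ J₁ J₂ J₃) (q : ZMod J₃) : fft (tconj A) q = (fft A q)ᴴ := by
  ext l i
  rw [conjTranspose_apply, ← Matrix.map_apply (f := star), ← fft_neg_index, fft_apply_apply,
    fft_apply_apply]
  refine Fintype.sum_equiv (Equiv.neg _) _ _ fun j => ?_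
  simp [tconj]

theorem fft_injective : Function.Injective (fft : Tensor ℝ J₁ J₂ J₃ → Tensor ℂ J₁ J₂ J₃) := by
  intro A B h
  have h' := ZMod.dft.injective h
  funext j
  ext i l
  simpa using congrFun (congrFun (congrFun h' j) i) l

/-- Under conjugate symmetry the inverse transform is fixed by entrywise conjugation, hence real.
Every real tensor prescribed by its Fourier slices is obtained this way. -/
theorem exists_fft_eq {X : Tensor ℂ J₁ J₂ J₃} (hX : ∀ q, X (-q) = (X q).map star) :
    ∃ A : Tensor ℝ J₁ J₂ J₃, fft A = X := by
  obtain ⟨Φ, rfl⟩ := ZMod.dft.surjective X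
  have hΦ : (fun j => (Φ j).map star) = Φ := by
    apply ZMod.dft.injective
    funext q
    rw [dft_map_star, hX]
    ext i l
    simp
  refine ⟨fun j => (Φ j).map Complex.re, ?_⟩
  rw [fft]
  congr 1
  funext j
  ext i l
  have := congrFun (congrFun (congrFun hΦ j) i) l
  exact Complex.conj_eq_iff_re.mp this

theorem fft_tid (q : ZMod J₃) : fft (tid J₁ J₃) q = 1 := by
  rw [fft_apply, Finset.sum_eq_single 0]
  · ext i l
    by_cases h : i = l <;> simp [tid, one_apply, h]
  · intro j _ hj
    ext i l
    simp [tid, hj]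
  · simp

theorem fft_add (A B : Tensor ℝ J₁ J₂ J₃) : fft (A + B) = fft A + fft B := by
  rw [fft, fft, fft, ← map_add]
  congr 1
  funext j
  ext i l
  simp

theorem fft_sub (A B : Tensor ℝ J₁ J₂ J₃) : fft (A - B) = fft A - fft B := by
  rw [eq_sub_iff_add_eq, ← fft_add, sub_add_cancel]

theorem sum_fft (A : Tensor ℝ J₁ J₂ J₃) :
    ∑ q, fft A q = (J₃ : ℂ) • (A 0).map Complex.ofReal := by
  have := congrFun (ZMod.dft_dft fun j => (A j).map Complex.ofReal) 0
  rw [ZMod.dft_apply_zero, neg_zero] at this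
  exact this

/-- Parseval's identity, read off from slice 0 of `Aᴴ * A`: its trace is the sum of the squared
entries, and slice 0 is the average of the Fourier slices. -/
theorem frobNorm_sq (A : Tensor ℝ J₁ J₂ J₃) :
    frobNorm A ^ 2 = 1 / (J₃ : ℝ) * ∑ q, frobInner (fft A q) (fft A q) := by
  have hJ : (J₃ : ℝ) ≠ 0 := by exact_mod_cast NeZero.ne J₃
  have h1 : ∑ q, frobInner (fft A q) (fft A q)
      = RCLike.re (∑ q, fft (tProduct (tconj A) A) q).trace := by
    simp only [frobInner, fft_tProduct, fft_tconj, trace_sum, map_sum]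
  have h2 : (tProduct (tconj A) A 0).trace = ∑ k, ∑ i, ∑ l, A k i l ^ 2 := by
    simp only [tProduct_apply, tconj, zero_sub, neg_neg, trace_sum]
    refine Finset.sum_congr rfl fun k _ => ?_
    have := frobInner_self (A k)
    simpa [frobInner] using this
  have h3 : ((tProduct (tconj A) A 0).map Complex.ofReal).trace
      = (((tProduct (tconj A) A 0).trace : ℝ) : ℂ) := by
    simp [trace]
  rw [h1, sum_fft, trace_smul, h3, h2, frobNorm, Real.sq_sqrt (by positivity), smul_eq_mul]
  simp only [RCLike.re_to_complex, Complex.re_mul_ofReal, Complex.natCast_re]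
  field_simp

theorem isOrthogonal_iff (Q : Tensor ℝ J₁ J₁ J₃) :
    IsOrthogonal Q ↔ ∀ q, fft Q q ∈ unitaryGroup (Fin J₁) ℂ := by
  constructor
  · intro h q
    rw [mem_unitaryGroup_iff, star_eq_conjTranspose, ← fft_tconj, ← fft_tProduct, h.1, fft_tid]
  · intro h
    constructor <;> apply fft_injective <;> funext q <;> rw [fft_tProduct, fft_tconj, fft_tid]
    · exact mem_unitaryGroup_iff.mp (h q)
    · exact mem_unitaryGroup_iff'.mp (h q)

theorem isFDiagonal_iff (S : Tensor ℝ J₁ J₂ J₃) :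
    IsFDiagonal S ↔ ∀ q (i : Fin J₁) (l : Fin J₂), (i : ℕ) ≠ l → fft S q i l = 0 := by
  constructor
  · intro h q i l hil
    simp [fft_apply_apply, h _ i l hil]
  · intro h j i l hil
    set Φ : ZMod J₃ → ℂ := fun j => (S j i l : ℂ)
    have : Φ = 0 := by
      apply ZMod.dft.injective
      rw [map_zero]
      funext q
      have := h q i l hil
      rw [fft_apply_apply] at this
      simpa [ZMod.dft_apply, Φ] using this
    simpa [Φ] using congrFun this j

theorem sigma_eq_singSeq (X : Matrix (Fin J₁) (Fin J₂) ℂ) (k : Fin (min J₁ J₂)) :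
    sigma X k = singSeq X k := rfl

theorem isFDiagonal_and_diagEntry_iff (S : Tensor ℝ J₁ J₂ J₃) (d : ZMod J₃ → ℕ → ℝ) :
    (IsFDiagonal S ∧ ∀ q (k : Fin (min J₁ J₂)), diagEntry (fft S q) k = (d q k : ℂ)) ↔
      ∀ q, fft S q = rectDiag ℂ J₁ J₂ (d q) := by
  rw [isFDiagonal_iff]
  constructor
  · rintro ⟨h1, h2⟩ q
    ext i l
    by_cases hil : (i : ℕ) = l
    · have := h2 q ⟨i, by omega⟩
      have hl : (⟨i, by omega⟩ : Fin J₂) = l := Fin.ext hil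
      simp only [diagEntry, Fin.castLE, hl] at this
      rw [this]
      simp [rectDiag, hil]
    · simp [h1 q i l hil, rectDiag, hil]
  · intro h
    refine ⟨fun q i l hil => by simp [h, rectDiag, hil], fun q k => by simp [h, diagEntry, rectDiag]⟩

/-- The t-SVDs with ordered diagonals are, in the Fourier domain, the singular value
decompositions of all frontal slices. -/
theorem isTSVD_and_hasSingularDiagonal_iff (A : Tensor ℝ J₁ J₂ J₃) (U : Tensor ℝ J₁ J₁ J₃)
    (S : Tensor ℝ J₁ J₂ J₃) (V : Tensor ℝ J₂ J₂ J₃) :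
    (IsTSVD A U S V ∧ HasSingularDiagonal S A) ↔
      (∀ q, fft U q ∈ unitaryGroup (Fin J₁) ℂ) ∧ (∀ q, fft V q ∈ unitaryGroup (Fin J₂) ℂ) ∧
      (∀ q, fft S q = rectDiag ℂ J₁ J₂ (singSeq (fft A q))) ∧
      ∀ q, fft A q = fft U q * rectDiag ℂ J₁ J₂ (singSeq (fft A q)) * (fft V q)ᴴ := by
  have hd := isFDiagonal_and_diagEntry_iff S fun q => singSeq (fft A q)
  constructor
  · rintro ⟨h, hs⟩
    have h1 := hd.mp ⟨h.fdiagonal, hs⟩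
    refine ⟨(isOrthogonal_iff U).mp h.left_orthogonal, (isOrthogonal_iff V).mp h.right_orthogonal,
      h1, fun q => ?_⟩
    rw [← h1 q, ← fft_tconj, ← fft_tProduct, ← fft_tProduct, ← h.factorization]
  · rintro ⟨hU, hV, hS, hA⟩
    have h1 := hd.mpr hS
    refine ⟨⟨(isOrthogonal_iff U).mpr hU, (isOrthogonal_iff V).mpr hV, h1.1, ?_⟩, h1.2⟩
    apply fft_injective
    funext q
    rw [fft_tProduct, fft_tProduct, fft_tconj, hS q]
    exact hA q

/-! ### Conjugate symmetry and existence of a real t-SVD -/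

theorem map_star_mem_unitaryGroup {N : ℕ} {U : Matrix (Fin N) (Fin N) ℂ}
    (hU : U ∈ unitaryGroup (Fin N) ℂ) : U.map star ∈ unitaryGroup (Fin N) ℂ := by
  rw [mem_unitaryGroup_iff] at hU ⊢
  have := congrArg (fun M => M.map (starRingEnd ℂ)) hU
  simp only [Matrix.map_mul] at this
  rw [Matrix.map_one _ (map_zero _) (map_one _)] at this
  exact this

theorem map_star_svd {U : Matrix (Fin J₁) (Fin J₁) ℂ} {V : Matrix (Fin J₂) (Fin J₂) ℂ}
    (d : ℕ → ℝ) : (U * rectDiag ℂ J₁ J₂ d * Vᴴ).map star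
      = U.map star * rectDiag ℂ J₁ J₂ d * (V.map star)ᴴ := by
  have h1 : (rectDiag ℂ J₁ J₂ d).map (starRingEnd ℂ) = rectDiag ℂ J₁ J₂ d := by
    ext i l
    by_cases h : (i : ℕ) = l <;> simp [rectDiag, h]
  have : (U * rectDiag ℂ J₁ J₂ d * Vᴴ).map (starRingEnd ℂ)
      = U.map (starRingEnd ℂ) * rectDiag ℂ J₁ J₂ d * (V.map (starRingEnd ℂ))ᴴ := by
    rw [Matrix.map_mul, Matrix.map_mul, h1]
    rfl
  exact this

theorem singSeq_map_star (A : Matrix (Fin J₁) (Fin J₂) ℂ) : singSeq (A.map star) = singSeq A := by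
  obtain ⟨U, hU, V, hV, hA⟩ := exists_svd A
  refine singSeq_eq_of_svd (isSingularSeq_singSeq A) (map_star_mem_unitaryGroup hU)
    (map_star_mem_unitaryGroup hV) ?_
  rw [← map_star_svd, ← hA]

theorem singSeq_fft_neg (A : Tensor ℝ J₁ J₂ J₃) (q : ZMod J₃) :
    singSeq (fft A (-q)) = singSeq (fft A q) := by
  rw [fft_neg_index, singSeq_map_star]

theorem map_ofReal_mem_unitaryGroup {N : ℕ} {U : Matrix (Fin N) (Fin N) ℝ}
    (hU : U ∈ unitaryGroup (Fin N) ℝ) : U.map Complex.ofReal ∈ unitaryGroup (Fin N) ℂ := by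
  rw [mem_unitaryGroup_iff] at hU ⊢
  have := congrArg (fun M => M.map Complex.ofRealHom) hU
  simp only [Matrix.map_mul] at this
  rw [Matrix.map_one _ (map_zero _) (map_one _)] at this
  refine Eq.trans ?_ this
  congr 1
  ext i j
  simp

/-- A complex matrix with real entries has a singular value decomposition with real factors. -/
theorem exists_real_svd {A : Matrix (Fin J₁) (Fin J₂) ℂ} (hA : A.map star = A) :
    ∃ U ∈ unitaryGroup (Fin J₁) ℂ, ∃ V ∈ unitaryGroup (Fin J₂) ℂ,
      A = U * rectDiag ℂ J₁ J₂ (singSeq A) * Vᴴ ∧ U.map star = U ∧ V.map star = V := by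
  obtain ⟨U, hU, V, hV, hR⟩ := exists_svd (A.map Complex.re)
  have hre : A = (A.map Complex.re).map Complex.ofRealHom := by
    ext i l
    exact (Complex.conj_eq_iff_re.mp (congrFun (congrFun hA i) l)).symm
  have hD : (rectDiag ℝ J₁ J₂ (singSeq (A.map Complex.re))).map Complex.ofRealHom
      = rectDiag ℂ J₁ J₂ (singSeq (A.map Complex.re)) := by
    ext i l
    by_cases h : (i : ℕ) = l <;> simp [rectDiag, h]
  have hfac : A = U.map Complex.ofReal * rectDiag ℂ J₁ J₂ (singSeq (A.map Complex.re))
      * (V.map Complex.ofReal)ᴴ := by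
    rw [hre]
    conv_lhs => rw [hR]
    rw [Matrix.map_mul, Matrix.map_mul, hD, ← hre]
    congr 1
    ext i l
    simp
  have hU' := map_ofReal_mem_unitaryGroup hU
  have hV' := map_ofReal_mem_unitaryGroup hV
  refine ⟨_, hU', _, hV', ?_, ?_, ?_⟩
  · rw [singSeq_eq_of_svd (isSingularSeq_singSeq _) hU' hV' hfac]
    exact hfac
  · ext i l; simp
  · ext i l; simp

/-- In each pair `{q, -q}` of distinct frequencies a solution is chosen freely at the smaller
representative and conjugated at the other. A frequency with `-q = q` needs a self-conjugate
solution. -/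
theorem exists_conj_symmetric_choice {α : Type*} (c : α → α) (hc : Function.Involutive c)
    (r : ZMod J₃ → α → Prop) (hr : ∀ q u, r q u → r (-q) (c u)) (hex : ∀ q, ∃ u, r q u)
    (hfix : ∀ q, -q = q → ∃ u, r q u ∧ c u = u) :
    ∃ f : ZMod J₃ → α, (∀ q, r q (f q)) ∧ ∀ q, f (-q) = c (f q) := by
  choose g hg using hex
  have hfix' : ∀ q, ∃ u, -q = q → r q u ∧ c u = u := by
    intro q
    by_cases h : -q = q
    · obtain ⟨u, hu⟩ := hfix q h
      exact ⟨u, fun _ => hu⟩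
    · exact ⟨g q, fun h' => absurd h' h⟩
  choose e he using hfix'
  refine ⟨fun q => if -q = q then e q else if q.val < (-q).val then g q else c (g (-q)), ?_, ?_⟩
  · intro q
    dsimp only
    split_ifs with h1 h2
    · exact (he q h1).1
    · exact hg q
    · simpa using hr _ _ (hg (-q))
  · intro q
    dsimp only
    by_cases h1 : -q = q
    · have h2 : - -q = -q := by rw [h1, h1]
      rw [if_pos h2, if_pos h1, h1, (he q h1).2]
    · have h2 : ¬ - -q = -q := by rw [neg_neg]; exact fun h => h1 h.symm
      rw [if_neg h2, if_neg h1, neg_neg]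
      have hne : q.val ≠ (-q).val := fun h => h1 (ZMod.val_injective _ h).symm
      rcases lt_or_gt_of_ne hne with h | h
      · rw [if_neg h.not_gt, if_pos h]
      · rw [if_pos h, if_neg h.not_gt, hc]

theorem exists_tsvd (A : Tensor ℝ J₁ J₂ J₃) :
    ∃ (U : Tensor ℝ J₁ J₁ J₃) (S : Tensor ℝ J₁ J₂ J₃) (V : Tensor ℝ J₂ J₂ J₃),
      IsTSVD A U S V ∧ HasSingularDiagonal S A := by
  obtain ⟨f, hf, hfneg⟩ := exists_conj_symmetric_choice (J₃ := J₃)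
    (α := Matrix (Fin J₁) (Fin J₁) ℂ × Matrix (Fin J₂) (Fin J₂) ℂ)
    (fun u => (u.1.map star, u.2.map star))
    (fun u => by ext <;> simp)
    (fun q u => u.1 ∈ unitaryGroup (Fin J₁) ℂ ∧ u.2 ∈ unitaryGroup (Fin J₂) ℂ ∧
      fft A q = u.1 * rectDiag ℂ J₁ J₂ (singSeq (fft A q)) * u.2ᴴ)
    (by
      rintro q u ⟨h1, h2, h3⟩
      refine ⟨map_star_mem_unitaryGroup h1, map_star_mem_unitaryGroup h2, ?_⟩
      rw [singSeq_fft_neg, fft_neg_index, ← map_star_svd, ← h3])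
    (by
      intro q
      obtain ⟨U, hU, V, hV, h⟩ := exists_svd (fft A q)
      exact ⟨(U, V), hU, hV, h⟩)
    (by
      intro q hq
      -- At a self-paired frequency the slice equals its own conjugate, so the factors can be taken
      -- real.
      obtain ⟨U, hU, V, hV, h, h1, h2⟩ := exists_real_svd (A := fft A q)
        (by rw [← fft_neg_index, hq])
      exact ⟨(U, V), ⟨hU, hV, h⟩, Prod.ext h1 h2⟩)
  obtain ⟨U, hU⟩ := exists_fft_eq (X := fun q => (f q).1) (fun q => congrArg Prod.fst (hfneg q))
  obtain ⟨V, hV⟩ := exists_fft_eq (X := fun q => (f q).2) (fun q => congrArg Prod.snd (hfneg q))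
  obtain ⟨S, hS⟩ := exists_fft_eq (X := fun q => rectDiag ℂ J₁ J₂ (singSeq (fft A q)))
    (fun q => by
      rw [singSeq_fft_neg]
      ext i l
      by_cases h : (i : ℕ) = l <;> simp [rectDiag, h])
  refine ⟨U, S, V, (isTSVD_and_hasSingularDiagonal_iff A U S V).mpr ⟨?_, ?_, ?_, ?_⟩⟩
  · intro q; rw [hU]; exact (hf q).1
  · intro q; rw [hV]; exact (hf q).2.1
  · intro q; rw [hS]
  · intro q; rw [hU, hV]; exact (hf q).2.2

end Fourier

/-! ### The scalar penalty and its proximal map -/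

section Scalar

variable {τ p ρ : ℝ}

theorem mpcp_abs (x : ℝ) : mpcp τ p |x| = mpcp τ p x := by
  simp [mpcp]

theorem mpcp_zero (hp : 0 < p) (hτ : 1 < τ) : mpcp τ p 0 = 0 := by
  have h : (0 : ℝ) ≤ τ ^ (1 / p) := by positivity
  rw [mpcp, abs_zero, if_pos h, Real.zero_rpow (by linarith)]
  simp

theorem mpcp_pos (hp : 0 < p) (hτ : 1 < τ) {x : ℝ} (hx : x ≠ 0) : 0 < mpcp τ p x := by
  have hτ0 : 0 < τ := by linarith
  have hx' : 0 < |x| := abs_pos.mpr hx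
  rw [mpcp]
  split_ifs with h
  · have h1 : |x| ^ p ≤ τ := by
      have := Real.rpow_le_rpow hx'.le h hp.le
      rwa [← Real.rpow_mul hτ0.le, one_div_mul_cancel hp.ne', Real.rpow_one] at this
    have h2 : |x| ^ (1 + p) = |x| * |x| ^ p := by
      rw [Real.rpow_add hx', Real.rpow_one]
    rw [h2, sub_pos, div_lt_iff₀ (by positivity)]
    have : |x| ^ p < (1 + p) * τ := by nlinarith
    exact mul_lt_mul_of_pos_left this hx'
  · positivity

theorem mpcp_nonneg (hp : 0 < p) (hτ : 1 < τ) (x : ℝ) : 0 ≤ mpcp τ p x := by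
  by_cases hx : x = 0
  · rw [hx, mpcp_zero hp hτ]
  · exact (mpcp_pos hp hτ hx).le

theorem continuous_mpcp (hp : 0 < p) (hτ : 1 < τ) : Continuous (mpcp τ p) := by
  have hτ0 : 0 < τ := by linarith
  refine Continuous.if_le ?_ continuous_const continuous_abs continuous_const ?_
  · refine continuous_abs.sub (Continuous.div_const ?_ _)
    exact continuous_abs.rpow_const fun x => Or.inr (by linarith)
  · intro x hx
    rw [hx, Real.rpow_add (by positivity), Real.rpow_one, ← Real.rpow_mul hτ0.le,
      one_div_mul_cancel hp.ne', Real.rpow_one]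
    field_simp
    ring

theorem mpcpProx_nonempty (hp : 0 < p) (hτ : 1 < τ) (hρ : 0 < ρ) (y : ℝ) :
    (mpcpProx τ p ρ y).Nonempty := by
  have hcont : Continuous fun x => 1 / 2 * (x - y) ^ 2 + ρ * mpcp τ p x := by
    have := continuous_mpcp (τ := τ) hp hτ
    fun_prop
  have h0 : 0 ≤ ρ * mpcp τ p y := mul_nonneg hρ.le (mpcp_nonneg hp hτ y)
  -- The radius satisfies `r ^ 2 / 2 ≥ ρ ψ(y)`, so outside the interval the quadratic term alone is
  -- at least the objective at `y`, and a minimum on the interval is global.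
  set r := ρ * mpcp τ p y + 1 with hr
  have hyr : y ∈ Set.Icc (y - r) (y + r) := ⟨by linarith, by linarith⟩
  have hrlt : ρ * mpcp τ p y ≤ 1 / 2 * r ^ 2 := by nlinarith
  obtain ⟨x, -, hx⟩ := isCompact_Icc.exists_isMinOn ⟨y, hyr⟩ hcont.continuousOn
  refine ⟨x, fun z => ?_⟩
  by_cases hz : z ∈ Set.Icc (y - r) (y + r)
  · exact hx hz
  · have hxy : 1 / 2 * (x - y) ^ 2 + ρ * mpcp τ p x ≤ 1 / 2 * (y - y) ^ 2 + ρ * mpcp τ p y :=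
      hx hyr
    have hz2 : r ^ 2 ≤ (z - y) ^ 2 := by
      rw [Set.mem_Icc, not_and_or, not_le, not_le] at hz
      rcases hz with h | h <;> nlinarith
    have := mul_nonneg hρ.le (mpcp_nonneg hp hτ z)
    nlinarith

theorem eq_zero_of_mem_mpcpProx_zero (hp : 0 < p) (hτ : 1 < τ) (hρ : 0 < ρ) {x : ℝ}
    (hx : x ∈ mpcpProx τ p ρ 0) : x = 0 := by
  by_contra h
  have h1 := hx 0
  rw [mpcp_zero hp hτ] at h1
  have := mul_pos hρ (mpcp_pos hp hτ h)
  nlinarith [sq_nonneg x]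

/-- Adding the two optimality conditions, each tested at the other's minimizer, cancels the penalty
and leaves `(x₁ - x₂) * (y₁ - y₂) ≥ 0`. -/
theorem mpcpProx_monotone {x₁ x₂ y₁ y₂ : ℝ} (hy : y₁ < y₂) (h₁ : x₁ ∈ mpcpProx τ p ρ y₁)
    (h₂ : x₂ ∈ mpcpProx τ p ρ y₂) : x₁ ≤ x₂ := by
  by_contra! h
  have := h₁ x₂
  have := h₂ x₁
  nlinarith [mul_pos (sub_pos.mpr h) (sub_pos.mpr hy)]

/-- This makes the shrunken diagonal the actual singular value list: order is kept by monotonicity,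
ties because `P` is a function, and the zero tail because 0 is the only minimizer at 0. -/
theorem IsSingularSeq.comp_mpcpProx (hp : 0 < p) (hτ : 1 < τ) (hρ : 0 < ρ) {m n : ℕ} {d : ℕ → ℝ}
    (hd : IsSingularSeq m n d) {P : ℝ → ℝ} (hP : ∀ y, P y ∈ mpcpProx τ p ρ y) :
    IsSingularSeq m n fun k => P (d k) where
  antitone i k hik := by
    rcases (hd.antitone hik).eq_or_lt with h | h
    · simp [h]
    · exact mpcpProx_monotone h (hP _) (hP _)
  eq_zero k hk := by
    have := hP 0
    simp only [hd.eq_zero k hk]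
    exact eq_zero_of_mem_mpcpProx_zero hp hτ hρ this

end Scalar

/-! ### Minimizers of the tensor problem -/

section Tensor

variable {J₁ J₂ J₃ : ℕ} [NeZero J₃] {τ p ρ : ℝ}

theorem objective_eq (B Y : Tensor ℝ J₁ J₂ J₃) :
    1 / 2 * frobNorm (B - Y) ^ 2 + ρ * tauNorm τ p B
      = 1 / (J₃ : ℝ) * ∑ q, (1 / 2 * frobInner (fft B q - fft Y q) (fft B q - fft Y q)
          + ∑ k : Fin (min J₁ J₂), ρ * mpcp τ p (singSeq (fft B q) k)) := by
  rw [frobNorm_sq, tauNorm, fft_sub]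
  simp only [Finset.sum_add_distrib, ← Finset.mul_sum, sigma_eq_singSeq, Pi.sub_apply]
  ring

/-- The frontal slices of two tensors satisfy von Neumann's trace inequality with equality. -/
def IsAligned (B Y : Tensor ℝ J₁ J₂ J₃) : Prop :=
  ∀ q, frobInner (fft B q - fft Y q) (fft B q - fft Y q)
    ≤ ∑ k : Fin (min J₁ J₂), (singSeq (fft B q) k - singSeq (fft Y q) k) ^ 2

theorem isAligned_of_svd {B Y : Tensor ℝ J₁ J₂ J₃}
    {U : Tensor ℂ J₁ J₁ J₃} (hU : ∀ q, U q ∈ unitaryGroup (Fin J₁) ℂ)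
    {V : Tensor ℂ J₂ J₂ J₃} (hV : ∀ q, V q ∈ unitaryGroup (Fin J₂) ℂ)
    (hB : ∀ q, fft B q = U q * rectDiag ℂ J₁ J₂ (singSeq (fft B q)) * (V q)ᴴ)
    (hY : ∀ q, fft Y q = U q * rectDiag ℂ J₁ J₂ (singSeq (fft Y q)) * (V q)ᴴ) :
    IsAligned B Y := by
  intro q
  have h : frobInner (fft B q) (fft Y q)
      = ∑ k : Fin (min J₁ J₂), singSeq (fft B q) k * singSeq (fft Y q) k := by
    conv_lhs => arg 1; rw [hB q]
    conv_lhs => arg 2; rw [hY q]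
    exact frobInner_svd_same (isSingularSeq_singSeq _) (hU q) (hV q)
  rw [frobInner_sub_self, frobInner_self_eq_sum, frobInner_self_eq_sum, h, sum_sub_sq]

/-- The objective function splits over the singular values from below. -/
theorem le_objective (B Y : Tensor ℝ J₁ J₂ J₃) :
    1 / (J₃ : ℝ) * ∑ q, ∑ k : Fin (min J₁ J₂),
        (1 / 2 * (singSeq (fft B q) k - singSeq (fft Y q) k) ^ 2
          + ρ * mpcp τ p (singSeq (fft B q) k))
      ≤ 1 / 2 * frobNorm (B - Y) ^ 2 + ρ * tauNorm τ p B := by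
  rw [objective_eq]
  refine mul_le_mul_of_nonneg_left (Finset.sum_le_sum fun q _ => ?_) (by positivity)
  rw [Finset.sum_add_distrib, ← Finset.mul_sum]
  linarith [sum_sq_sub_singSeq_le (fft B q) (fft Y q)]

theorem IsAligned.objective_le {B Y : Tensor ℝ J₁ J₂ J₃} (h : IsAligned B Y) :
    1 / 2 * frobNorm (B - Y) ^ 2 + ρ * tauNorm τ p B
      ≤ 1 / (J₃ : ℝ) * ∑ q, ∑ k : Fin (min J₁ J₂),
        (1 / 2 * (singSeq (fft B q) k - singSeq (fft Y q) k) ^ 2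
          + ρ * mpcp τ p (singSeq (fft B q) k)) := by
  rw [objective_eq]
  refine mul_le_mul_of_nonneg_left (Finset.sum_le_sum fun q _ => ?_) (by positivity)
  simp only [Finset.sum_add_distrib, ← Finset.mul_sum]
  linarith [h q]

theorem IsAligned.mem_tauProx {B Y : Tensor ℝ J₁ J₂ J₃} (h : IsAligned B Y)
    (hprox : ∀ q (k : Fin (min J₁ J₂)),
      singSeq (fft B q) k ∈ mpcpProx τ p ρ (singSeq (fft Y q) k)) : B ∈ tauProx τ p ρ Y := by
  intro C
  refine h.objective_le.trans (le_trans ?_ (le_objective C Y))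
  exact mul_le_mul_of_nonneg_left (Finset.sum_le_sum fun q _ => Finset.sum_le_sum fun k _ =>
    hprox q k _) (by positivity)

theorem exists_fDiagonal (Y : Tensor ℝ J₁ J₂ J₃) (P : ℝ → ℝ) :
    ∃ S : Tensor ℝ J₁ J₂ J₃,
      ∀ q, fft S q = rectDiag ℂ J₁ J₂ fun k => P (singSeq (fft Y q) k) := by
  obtain ⟨S, hS⟩ := exists_fft_eq
    (X := fun q => rectDiag ℂ J₁ J₂ fun k => P (singSeq (fft Y q) k)) (fun q => by
      rw [singSeq_fft_neg]
      ext i l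
      by_cases h : (i : ℕ) = l <;> simp [rectDiag, h])
  exact ⟨S, fun q => congrFun hS q⟩

section Shrinkage

variable {Y S : Tensor ℝ J₁ J₂ J₃} {M : Tensor ℝ J₁ J₁ J₃} {Q : Tensor ℝ J₂ J₂ J₃} {P : ℝ → ℝ}

theorem fft_shrinkage (hS : ∀ q, fft S q = rectDiag ℂ J₁ J₂ fun k => P (singSeq (fft Y q) k))
    (q : ZMod J₃) : fft (tProduct (tProduct M S) (tconj Q)) q
      = fft M q * rectDiag ℂ J₁ J₂ (fun k => P (singSeq (fft Y q) k)) * (fft Q q)ᴴ := by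
  rw [fft_tProduct, fft_tProduct, fft_tconj, hS]

theorem singSeq_shrinkage (hp : 0 < p) (hτ : 1 < τ) (hρ : 0 < ρ)
    (hM : ∀ q, fft M q ∈ unitaryGroup (Fin J₁) ℂ) (hQ : ∀ q, fft Q q ∈ unitaryGroup (Fin J₂) ℂ)
    (hP : ∀ y, P y ∈ mpcpProx τ p ρ y)
    (hS : ∀ q, fft S q = rectDiag ℂ J₁ J₂ fun k => P (singSeq (fft Y q) k)) (q : ZMod J₃) :
    singSeq (fft (tProduct (tProduct M S) (tconj Q)) q) = fun k => P (singSeq (fft Y q) k) :=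
  singSeq_eq_of_svd ((isSingularSeq_singSeq _).comp_mpcpProx hp hτ hρ hP) (hM q) (hQ q)
    (fft_shrinkage hS q)

theorem isAligned_shrinkage (hp : 0 < p) (hτ : 1 < τ) (hρ : 0 < ρ)
    (hM : ∀ q, fft M q ∈ unitaryGroup (Fin J₁) ℂ) (hQ : ∀ q, fft Q q ∈ unitaryGroup (Fin J₂) ℂ)
    (hY : ∀ q, fft Y q = fft M q * rectDiag ℂ J₁ J₂ (singSeq (fft Y q)) * (fft Q q)ᴴ)
    (hP : ∀ y, P y ∈ mpcpProx τ p ρ y)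
    (hS : ∀ q, fft S q = rectDiag ℂ J₁ J₂ fun k => P (singSeq (fft Y q) k)) :
    IsAligned (tProduct (tProduct M S) (tconj Q)) Y :=
  isAligned_of_svd hM hQ (fun q => by
    rw [singSeq_shrinkage hp hτ hρ hM hQ hP hS, fft_shrinkage hS]) hY

theorem shrinkage_mem_tauProx (hp : 0 < p) (hτ : 1 < τ) (hρ : 0 < ρ)
    (hM : ∀ q, fft M q ∈ unitaryGroup (Fin J₁) ℂ) (hQ : ∀ q, fft Q q ∈ unitaryGroup (Fin J₂) ℂ)
    (hY : ∀ q, fft Y q = fft M q * rectDiag ℂ J₁ J₂ (singSeq (fft Y q)) * (fft Q q)ᴴ)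
    (hP : ∀ y, P y ∈ mpcpProx τ p ρ y)
    (hS : ∀ q, fft S q = rectDiag ℂ J₁ J₂ fun k => P (singSeq (fft Y q) k)) :
    tProduct (tProduct M S) (tconj Q) ∈ tauProx τ p ρ Y :=
  (isAligned_shrinkage hp hτ hρ hM hQ hY hP hS).mem_tauProx fun q k => by
    rw [singSeq_shrinkage hp hτ hρ hM hQ hP hS]
    exact hP _

end Shrinkage

/-- A minimizer is compared with the shrinkage of `Y`, which attains the separated lower bound. The
resulting chain of inequalities closes up, so equality holds in every slice and then for every
singular value. -/
theorem mem_tauProx_iff (hp : 0 < p) (hτ : 1 < τ) (hρ : 0 < ρ) {B Y : Tensor ℝ J₁ J₂ J₃} :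
    B ∈ tauProx τ p ρ Y ↔ IsAligned B Y ∧ ∀ q (k : Fin (min J₁ J₂)),
      singSeq (fft B q) k ∈ mpcpProx τ p ρ (singSeq (fft Y q) k) := by
  refine ⟨fun hB => ?_, fun h => h.1.mem_tauProx h.2⟩
  choose P hP using fun y => mpcpProx_nonempty (τ := τ) hp hτ hρ y
  obtain ⟨M, S₂, Q, hsvd⟩ := exists_tsvd Y
  obtain ⟨hM, hQ, -, hY⟩ := (isTSVD_and_hasSingularDiagonal_iff Y M S₂ Q).mp hsvd
  obtain ⟨S, hS⟩ := exists_fDiagonal Y P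
  have hle := (hB (tProduct (tProduct M S) (tconj Q))).trans
    (isAligned_shrinkage hp hτ hρ hM hQ hY hP hS).objective_le
  have hJ : 0 < 1 / (J₃ : ℝ) := by
    have : 0 < (J₃ : ℝ) := by exact_mod_cast NeZero.pos J₃
    positivity
  rw [objective_eq, mul_le_mul_iff_right₀ hJ] at hle
  simp only [singSeq_shrinkage hp hτ hρ hM hQ hP hS] at hle
  set b : ZMod J₃ → ℕ → ℝ := fun q => singSeq (fft B q) with hb
  set y : ZMod J₃ → ℕ → ℝ := fun q => singSeq (fft Y q) with hy
  have hmin : ∀ q (k : Fin (min J₁ J₂)),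
      1 / 2 * (P (y q k) - y q k) ^ 2 + ρ * mpcp τ p (P (y q k))
        ≤ 1 / 2 * (b q k - y q k) ^ 2 + ρ * mpcp τ p (b q k) := fun q k => hP (y q k) (b q k)
  have hslice1 : ∀ q, ∑ k : Fin (min J₁ J₂),
      (1 / 2 * (P (y q k) - y q k) ^ 2 + ρ * mpcp τ p (P (y q k)))
        ≤ ∑ k : Fin (min J₁ J₂), (1 / 2 * (b q k - y q k) ^ 2 + ρ * mpcp τ p (b q k)) :=
    fun q => Finset.sum_le_sum fun k _ => hmin q k
  have hslice2 : ∀ q, ∑ k : Fin (min J₁ J₂),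
      (1 / 2 * (b q k - y q k) ^ 2 + ρ * mpcp τ p (b q k))
        ≤ 1 / 2 * frobInner (fft B q - fft Y q) (fft B q - fft Y q)
          + ∑ k : Fin (min J₁ J₂), ρ * mpcp τ p (b q k) := by
    intro q
    rw [Finset.sum_add_distrib, ← Finset.mul_sum]
    linarith [sum_sq_sub_singSeq_le (fft B q) (fft Y q)]
  have heq : ∀ q, ∑ k : Fin (min J₁ J₂),
      (1 / 2 * (P (y q k) - y q k) ^ 2 + ρ * mpcp τ p (P (y q k)))
        = 1 / 2 * frobInner (fft B q - fft Y q) (fft B q - fft Y q)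
          + ∑ k : Fin (min J₁ J₂), ρ * mpcp τ p (b q k) := fun q =>
    (Finset.sum_eq_sum_iff_of_le fun q _ => (hslice1 q).trans (hslice2 q)).mp
      (le_antisymm (Finset.sum_le_sum fun q _ => (hslice1 q).trans (hslice2 q)) hle) q
      (Finset.mem_univ q)
  constructor
  · intro q
    have h1 := hslice1 q
    rw [heq q] at h1
    conv_rhs at h1 => rw [Finset.sum_add_distrib, ← Finset.mul_sum]
    linarith
  · intro q k z
    have h1 := (Finset.sum_eq_sum_iff_of_le fun k _ => hmin q k).mp
      (le_antisymm (hslice1 q) ((hslice2 q).trans_eq (heq q).symm)) k (Finset.mem_univ k)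
    exact h1.symm.trans_le (hP (y q k) z)

/-- Aligned tensors have a joint t-SVD. -/
theorem IsAligned.exists_joint_svd {B Y : Tensor ℝ J₁ J₂ J₃} (h : IsAligned B Y) :
    ∃ (M : Tensor ℝ J₁ J₁ J₃) (Q : Tensor ℝ J₂ J₂ J₃),
      (∀ q, fft M q ∈ unitaryGroup (Fin J₁) ℂ) ∧ (∀ q, fft Q q ∈ unitaryGroup (Fin J₂) ℂ) ∧
      (∀ q, fft B q = fft M q * rectDiag ℂ J₁ J₂ (singSeq (fft B q)) * (fft Q q)ᴴ) ∧
      ∀ q, fft Y q = fft M q * rectDiag ℂ J₁ J₂ (singSeq (fft Y q)) * (fft Q q)ᴴ := by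
  -- Decomposing the real tensor `B + Y` builds conjugate symmetry into the common factors, with no
  -- joint choice over the frequencies.
  obtain ⟨M, S, Q, hsvd⟩ := exists_tsvd (B + Y)
  obtain ⟨hM, hQ, -, hsum⟩ := (isTSVD_and_hasSingularDiagonal_iff (B + Y) M S Q).mp hsvd
  have hjoint := fun q => svd_of_frobInner_sub_self_le (h q) (isSingularSeq_singSeq (fft (B + Y) q))
    (hM q) (hQ q) (by rw [← hsum q, fft_add, Pi.add_apply])
  exact ⟨M, Q, hM, hQ, fun q => (hjoint q).1, fun q => (hjoint q).2⟩

theorem exists_isTSVD_of_svd {A : Tensor ℝ J₁ J₂ J₃} {M : Tensor ℝ J₁ J₁ J₃}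
    {Q : Tensor ℝ J₂ J₂ J₃} (hM : ∀ q, fft M q ∈ unitaryGroup (Fin J₁) ℂ)
    (hQ : ∀ q, fft Q q ∈ unitaryGroup (Fin J₂) ℂ)
    (hA : ∀ q, fft A q = fft M q * rectDiag ℂ J₁ J₂ (singSeq (fft A q)) * (fft Q q)ᴴ) :
    ∃ S : Tensor ℝ J₁ J₂ J₃, IsTSVD A M S Q ∧ HasSingularDiagonal S A := by
  obtain ⟨S, hS⟩ := exists_fDiagonal A id
  exact ⟨S, (isTSVD_and_hasSingularDiagonal_iff A M S Q).mpr ⟨hM, hQ, hS, hA⟩⟩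

theorem tauProx_eq_singleton (hp : 0 < p) (hτ : 1 < τ) (hρ : 0 < ρ) {Y S : Tensor ℝ J₁ J₂ J₃}
    {M : Tensor ℝ J₁ J₁ J₃} {Q : Tensor ℝ J₂ J₂ J₃} {P : ℝ → ℝ}
    (hM : ∀ q, fft M q ∈ unitaryGroup (Fin J₁) ℂ) (hQ : ∀ q, fft Q q ∈ unitaryGroup (Fin J₂) ℂ)
    (hY : ∀ q, fft Y q = fft M q * rectDiag ℂ J₁ J₂ (singSeq (fft Y q)) * (fft Q q)ᴴ)
    (hP : ∀ y, P y ∈ mpcpProx τ p ρ y)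
    (hS : ∀ q, fft S q = rectDiag ℂ J₁ J₂ fun k => P (singSeq (fft Y q) k))
    (hsub : ∀ q (k : Fin (min J₁ J₂)), (mpcpProx τ p ρ (singSeq (fft Y q) k)).Subsingleton) :
    tauProx τ p ρ Y = {tProduct (tProduct M S) (tconj Q)} := by
  refine Set.eq_singleton_iff_unique_mem.mpr
    ⟨shrinkage_mem_tauProx hp hτ hρ hM hQ hY hP hS, fun B hB => ?_⟩
  obtain ⟨halign, hprox⟩ := (mem_tauProx_iff hp hτ hρ).mp hB
  obtain ⟨M', Q', hM', hQ', hB', hY'⟩ := halign.exists_joint_svd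
  apply fft_injective
  funext q
  have hs : singSeq (fft B q) = fun k => P (singSeq (fft Y q) k) :=
    (isSingularSeq_singSeq _).ext ((isSingularSeq_singSeq _).comp_mpcpProx hp hτ hρ hP)
      fun k => hsub q k (hprox q k) (hP _)
  rw [fft_shrinkage hS, hB' q, hs]
  -- The factors shared by `B` and `Y` need not be `M` and `Q`, but both pairs decompose `Y`, so
  -- shrinking gives the same tensor.
  exact svd_comp_eq (isSingularSeq_singSeq _) (eq_zero_of_mem_mpcpProx_zero hp hτ hρ (hP 0))
    (hM' q) (hM q) (hQ' q) (hQ q) ((hY' q).symm.trans (hY q))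

end Tensor

end TensorProx

/-! ### The main theorem -/

theorem theorem4 {J₁ J₂ J₃ : ℕ} [NeZero J₃] (τ p ρ : ℝ) (hτ : 1 < τ) (hp₀ : 0 < p) (hp₁ : p < 1)
    (hρ : 0 < ρ) (Y : TensorProx.Tensor ℝ J₁ J₂ J₃) :
    -- the scalar proximal operator is defined everywhere
    (∀ y : ℝ, (TensorProx.mpcpProx τ p ρ y).Nonempty) ∧
    -- `Y` has a t-SVD whose Fourier-domain diagonals are the singular values of the slices
    (∃ (M : TensorProx.Tensor ℝ J₁ J₁ J₃) (S₂ : TensorProx.Tensor ℝ J₁ J₂ J₃)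
      (Q : TensorProx.Tensor ℝ J₂ J₂ J₃), TensorProx.IsTSVD Y M S₂ Q ∧
        TensorProx.HasSingularDiagonal S₂ Y) ∧
    -- for every such t-SVD and every single-valued version `P` of the scalar proximal operator,
    -- the formula determines a real tensor, which is a value of the tensor proximal operator, and
    -- its only value if the scalar one is single-valued at the singular values
    (∀ (M : TensorProx.Tensor ℝ J₁ J₁ J₃) (S₂ : TensorProx.Tensor ℝ J₁ J₂ J₃)
      (Q : TensorProx.Tensor ℝ J₂ J₂ J₃), TensorProx.IsTSVD Y M S₂ Q →
        TensorProx.HasSingularDiagonal S₂ Y →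
      ∀ P : ℝ → ℝ, (∀ y, P y ∈ TensorProx.mpcpProx τ p ρ y) →
        ∃ S₁ : TensorProx.Tensor ℝ J₁ J₂ J₃,
          (∀ S : TensorProx.Tensor ℝ J₁ J₂ J₃,
            (TensorProx.IsFDiagonal S ∧ ∀ j k, TensorProx.diagEntry (TensorProx.fft S j) k =
              (P (TensorProx.sigma (TensorProx.fft Y j) k) : ℂ)) ↔ S = S₁) ∧
          TensorProx.tProduct (TensorProx.tProduct M S₁) (TensorProx.tconj Q) ∈
            TensorProx.tauProx τ p ρ Y ∧
          (∀ j k, TensorProx.sigma (TensorProx.fft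
              (TensorProx.tProduct (TensorProx.tProduct M S₁) (TensorProx.tconj Q)) j) k =
            P (TensorProx.sigma (TensorProx.fft Y j) k)) ∧
          ((∀ j k, (TensorProx.mpcpProx τ p ρ
              (TensorProx.sigma (TensorProx.fft Y j) k)).Subsingleton) →
            TensorProx.tauProx τ p ρ Y =
              {TensorProx.tProduct (TensorProx.tProduct M S₁) (TensorProx.tconj Q)})) ∧
    -- all values of the tensor proximal operator
    (∀ B : TensorProx.Tensor ℝ J₁ J₂ J₃, B ∈ TensorProx.tauProx τ p ρ Y ↔
      ∃ (M : TensorProx.Tensor ℝ J₁ J₁ J₃) (S₁ S₂ : TensorProx.Tensor ℝ J₁ J₂ J₃)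
        (Q : TensorProx.Tensor ℝ J₂ J₂ J₃),
        TensorProx.IsTSVD Y M S₂ Q ∧
        TensorProx.HasSingularDiagonal S₂ Y ∧
        TensorProx.IsTSVD B M S₁ Q ∧
        TensorProx.HasSingularDiagonal S₁ B ∧
        ∀ j k, TensorProx.sigma (TensorProx.fft B j) k ∈
          TensorProx.mpcpProx τ p ρ (TensorProx.sigma (TensorProx.fft Y j) k)) := by
  refine ⟨TensorProx.mpcpProx_nonempty hp₀ hτ hρ, TensorProx.exists_tsvd Y, ?_, ?_⟩
  · intro M S₂ Q hsvd hdiag P hP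
    obtain ⟨hM, hQ, -, hY⟩ :=
      (TensorProx.isTSVD_and_hasSingularDiagonal_iff Y M S₂ Q).mp ⟨hsvd, hdiag⟩
    obtain ⟨S₁, hS₁⟩ := TensorProx.exists_fDiagonal Y P
    refine ⟨S₁, fun S => ?_, TensorProx.shrinkage_mem_tauProx hp₀ hτ hρ hM hQ hY hP hS₁,
      fun j k => ?_, TensorProx.tauProx_eq_singleton hp₀ hτ hρ hM hQ hY hP hS₁⟩
    · refine (TensorProx.isFDiagonal_and_diagEntry_iff S
        fun q k => P (TensorProx.singSeq (TensorProx.fft Y q) k)).trans ⟨fun h => ?_, ?_⟩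
      · exact TensorProx.fft_injective (funext fun q => (h q).trans (hS₁ q).symm)
      · rintro rfl
        exact hS₁
    · rw [TensorProx.sigma_eq_singSeq,
        TensorProx.singSeq_shrinkage hp₀ hτ hρ hM hQ hP hS₁, TensorProx.sigma_eq_singSeq]
  · intro B
    rw [TensorProx.mem_tauProx_iff hp₀ hτ hρ]
    constructor
    · rintro ⟨halign, hprox⟩
      obtain ⟨M, Q, hM, hQ, hB, hY⟩ := halign.exists_joint_svd
      obtain ⟨S₁, h₁, h₁'⟩ := TensorProx.exists_isTSVD_of_svd hM hQ hB
      obtain ⟨S₂, h₂, h₂'⟩ := TensorProx.exists_isTSVD_of_svd hM hQ hY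
      exact ⟨M, S₁, S₂, Q, h₂, h₂', h₁, h₁', hprox⟩
    · rintro ⟨M, S₁, S₂, Q, h₂, h₂', h₁, h₁', hprox⟩
      obtain ⟨hM, hQ, -, hY⟩ :=
        (TensorProx.isTSVD_and_hasSingularDiagonal_iff Y M S₂ Q).mp ⟨h₂, h₂'⟩
      obtain ⟨-, -, -, hB⟩ := (TensorProx.isTSVD_and_hasSingularDiagonal_iff B M S₁ Q).mp ⟨h₁, h₁'⟩
      exact ⟨TensorProx.isAligned_of_svd hM hQ hB hY, hprox⟩
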